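/- Let $\Xi$ be a finite set of sites, each carrying the Hilbert space $\mathbb{C}^{d_0}$, and let $H=\sum_{i_1,\ldots,i_k\in\Xi}h_{i_1,\ldots,i_k}$ be a $k$-local Hamiltonian on $(\mathbb{C}^{d_0})^{\otimes\Xi}$: $H$ is self-adjoint, the sum runs over all $k$-tuples of sites, and the support of $h_{i_1,\ldots,i_k}$ is contained in $\{i_1,\ldots,i_k\}$. Suppose that $\|h_{i_1,\ldots,i_k}\|\le\bar h$ (operator norm) for every choice of $i_1,\ldots,i_k$. Let $\rho$ be an arbitrary density matrix, $\rho(t)=e^{-itH}\rho\,e^{itH}$, let $\Xi=A\sqcup\bar A$ be a bipartition, $\rho_A(t)=\operatorname{Tr}_{\bar A}\rho(t)$, and $$S_\alpha(t)=\frac{1}{1-\alpha}\log\operatorname{Tr}\rho_A(t)^\alpha\quad(\alpha\ne1),\qquad S_1(t)=-\operatorname{Tr}\rho_A(t)\log\rho_A(t).$$ Let $V(H_\partial)$ be the number of index tuples $(i_1,\ldots,i_k)$ with $h_{i_1,\ldots,i_k}\neq0$ for which $\{i_1,\ldots,i_k\}$ meets both $A$ and $\bar A$. Then for every real $\alpha>1/2$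 the function $S_\alpha$ is differentiable at every $t\in\mathbb{R}$, and $$|S_\alpha'(t)|\le V(H_\partial)\,\bar h\begin{cases}c\,(k-1)\log d_0&\alpha=1,\\ c'\,d_0^{2(k-1)}&\alpha\neq1,\end{cases}$$ where $c$ is an absolute constant and $c'$ depends only on $\alpha$; in particular neither depends on $\Xi,d_0,k,H,\bar h,\rho,A$ or $t$. -/

import Mathlib

namespace QuditEntropy

/-- Operators on the Hilbert space `(ℂ^d₀)^{⊗ Ξ}` of qudits of dimension `d₀` on the sites `Ξ`,
as matrices in the product basis, whose vectors are labelled by the configurations `Ξ → Fin d₀`. -/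
abbrev Op (Ξ : Type*) (d₀ : ℕ) : Type _ := Matrix (Ξ → Fin d₀) (Ξ → Fin d₀) ℂ

/-- The operator norm induced by the Hilbert space norm. -/
noncomputable def opNorm {Ξ : Type*} [Fintype Ξ] [DecidableEq Ξ] {d₀ : ℕ} (M : Op Ξ d₀) : ℝ :=
  ‖Matrix.toEuclideanCLM (n := Ξ → Fin d₀) (𝕜 := ℂ) M‖

open Classical in
/-- The support of `M` is contained in `Λ`: `M = M_Λ ⊗ I` for an operator `M_Λ` on the sites
in `Λ` and the identity `I` on the other sites. -/
def IsSupportedOn {Ξ : Type*} {d₀ : ℕ} (Λ : Set Ξ) (M : Op Ξ d₀) : Prop :=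
  ∃ MΛ : Op Λ d₀, ∀ σ τ : Ξ → Fin d₀,
    M σ τ = if ∀ i, i ∉ Λ → σ i = τ i then MΛ (fun i => σ i) (fun i => τ i) else 0

open scoped ComplexOrder in
/-- Density matrices. -/
def IsDensity {Ξ : Type*} [Fintype Ξ] [DecidableEq Ξ] {d₀ : ℕ} (ρ : Op Ξ d₀) : Prop :=
  ρ.PosSemidef ∧ ρ.trace = 1

/-- The configuration on `Ξ` that is `a` on `A` and `b` on the complement of `A`. -/
def glue {Ξ : Type*} [DecidableEq Ξ] {d₀ : ℕ} (A : Finset Ξ)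
    (a : {i // i ∈ A} → Fin d₀) (b : {i // i ∉ A} → Fin d₀) : Ξ → Fin d₀ :=
  fun i => if hi : i ∈ A then a ⟨i, hi⟩ else b ⟨i, hi⟩

/-- The reduced operator on `A`: the partial trace over the complement of `A`. -/
def reduced {Ξ : Type*} [Fintype Ξ] [DecidableEq Ξ] {d₀ : ℕ} (A : Finset Ξ) (ρ : Op Ξ d₀) :
    Op {i // i ∈ A} d₀ :=
  fun a a' => ∑ b : {i // i ∉ A} → Fin d₀, ρ (glue A a b) (glue A a' b)

/-- The Rényi entropy `(1 - α)⁻¹ log Tr ρ^α`, and for `α = 1` the von Neumann entropy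
`- Tr ρ log ρ`, where `ρ^α` and `- ρ log ρ` are given by the functional calculus. -/
noncomputable def renyiEntropy {Ξ : Type*} [Fintype Ξ] [DecidableEq Ξ] {d₀ : ℕ} (α : ℝ)
    (ρ : Op Ξ d₀) : ℝ :=
  if α = 1 then (cfc (fun x : ℝ => -(x * Real.log x)) ρ).trace.re
  else (1 - α)⁻¹ * Real.log (cfc (fun x : ℝ => x ^ α) ρ).trace.re

/-- The time evolved state `e^{-itH} ρ e^{itH}`. -/
noncomputable def evolve {Ξ : Type*} [Fintype Ξ] [DecidableEq Ξ] {d₀ : ℕ} (H ρ : Op Ξ d₀)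
    (t : ℝ) : Op Ξ d₀ :=
  NormedSpace.exp ((-(Complex.I * t)) • H) * ρ * NormedSpace.exp ((Complex.I * t) • H)

/-- The entropy `S_α(t)` of the subsystem `A` at time `t`, from the initial state `ρ`. -/
noncomputable def entropyAt {Ξ : Type*} [Fintype Ξ] [DecidableEq Ξ] {d₀ : ℕ} (H ρ : Op Ξ d₀)
    (A : Finset Ξ) (α t : ℝ) : ℝ :=
  renyiEntropy α (reduced A (evolve H ρ t))

/-- The Hamiltonian `H = ∑ h_{i_1, …, i_k}`, the sum running over all `k`-tuples of sites. -/
def hamiltonian {Ξ : Type*} [Fintype Ξ] [DecidableEq Ξ] {d₀ k : ℕ}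
    (h : (Fin k → Ξ) → Op Ξ d₀) : Op Ξ d₀ :=
  ∑ i : Fin k → Ξ, h i

/-- The family `h` presents a `k`-local Hamiltonian: the support of `h_{i_1, …, i_k}` is contained
in `{i_1, …, i_k}`, and the sum `H` is self-adjoint. -/
structure IsKLocal {Ξ : Type*} [Fintype Ξ] [DecidableEq Ξ] {d₀ k : ℕ}
    (h : (Fin k → Ξ) → Op Ξ d₀) : Prop where
  supported : ∀ i : Fin k → Ξ, IsSupportedOn (Set.range i) (h i)
  isHermitian : (hamiltonian h).IsHermitian

/-- `V(H_∂)`: the number of nonvanishing terms `h_{i_1, …, i_k}` for which `{i_1, …, i_k}` meets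
both `A` and its complement. -/
noncomputable def numStraddling {Ξ : Type*} {d₀ k : ℕ} (h : (Fin k → Ξ) → Op Ξ d₀)
    (A : Finset Ξ) : ℕ :=
  {i : Fin k → Ξ | h i ≠ 0 ∧ (∃ a, i a ∈ A) ∧ (∃ b, i b ∉ A)}.ncard

end QuditEntropy

/-! Write `R` for the reduced state on `A`. The derivative of `Tr f(R(t))` is `Tr f'(R) R'`, and
`R'` is the partial trace of `-i[H, ρ(t)]`, so it splits into one contribution per term of `H`. A
term supported inside `A` contributes nothing because `f'(R)` commutes with `R`, and one supported
outside `A` because it commutes with `f'(R) ⊗ 1`. For a straddling term `h`, let `X` be the reduced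
state on `A` together with the sites of the support outside `A`, a factor of dimension `D ≤
d₀^(k-1)`. The contribution is, up to a phase, `Tr h [X, f'(R) ⊗ 1]`
(`trace_mul_partialTrace_commutator`).

The task is to bound this commutator although `f'` may be unbounded near zero. The pinching
inequality gives `X ≤ D (R ⊗ 1)` (`posSemidef_card_smul_partialTrace_sub`). With `w = R ⊗ 1`
diagonalized, `X = w^(1/2) Z w^(1/2)` with `‖Z‖ ≤ D`. The entire function `F(z) = Tr h w^z Z
w^(β-z)` is at most `‖h‖ D Tr w^β` on the lines `Re z = 0` and `Re z = β`, hence between them by the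
three lines theorem. For `α ≠ 1` take `β = α`: the commutator is `α (F(1/2) - F(α - 1/2))`, and `Tr
w^α = D Tr R^α` produces `D²` times the trace that the logarithm divides by. For `α = 1` take `β =
1`: the commutator is `F'(1/2)`. On the middle line `|F| ≤ ‖h‖`, as `Tr X = 1`; the edges cost only
a factor `D²`, and Cauchy's estimate on a disc of radius of order `1 / log D` gives `O(‖h‖ log D)`
(`norm_deriv_interpTrace_le`).

Differentiability needs care where eigenvalues vanish, since `f` need not be differentiable at zero.
`hasDerivAt_trace_cfc` expands the first-order remainder in overlaps of eigenvectors at two times,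
with no regularity of the eigenvectors. An expectation of `R(t)` that vanishes at `t₀` is
nonnegative and `C²`, so it is `O((t-t₀)²)`; a Hölder exponent above `1/2` turns this into
`o(t-t₀)`. This is where `α > 1/2` is needed. -/

namespace QuditEntropy

set_option linter.unusedSectionVars false

/-! ### Three lines interpolation for traces with complex powers -/

section Interpolation

open Matrix Complex
open scoped Matrix.Norms.L2Operator ComplexOrder Kronecker

variable {n : Type*} [Fintype n] [DecidableEq n]

lemma norm_entry_le_norm (M : Matrix n n ℂ) (i j : n) : ‖M i j‖ ≤ ‖M‖ := by
  have h := M.l2_opNorm_mulVec (EuclideanSpace.single j (1 : ℂ))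
  rw [PiLp.norm_single, norm_one, mul_one] at h
  refine le_trans ?_ h
  have := PiLp.norm_apply_le ((EuclideanSpace.equiv n ℂ).symm (M *ᵥ (EuclideanSpace.single j (1 : ℂ)).ofLp)) i
  simpa using this

lemma norm_trace_mul_diagonal_le (M : Matrix n n ℂ) (x : n → ℂ) :
    ‖(M * diagonal x).trace‖ ≤ ‖M‖ * ∑ i, ‖x i‖ := by
  simp only [Matrix.trace, Matrix.diag_apply, Matrix.mul_diagonal]
  rw [Finset.mul_sum]
  refine (norm_sum_le _ _).trans (Finset.sum_le_sum fun i _ => ?_)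
  rw [norm_mul]
  gcongr
  exact norm_entry_le_norm M i i

lemma norm_unitary_conj_le (U : Matrix.unitaryGroup n ℂ) (M : Matrix n n ℂ) :
    ‖(star U : Matrix n n ℂ) * M * U‖ ≤ ‖M‖ := by
  rw [CStarRing.norm_mul_coe_unitary]
  exact (CStarRing.norm_coe_unitary_mul (star U) M).le

lemma norm_trace_mul_posSemidef_le (M : Matrix n n ℂ) {X : Matrix n n ℂ} (hX : X.PosSemidef) :
    ‖(M * X).trace‖ ≤ ‖M‖ * X.trace.re := by
  have hs := hX.isHermitian.spectral_theorem
  rw [Unitary.conjStarAlgAut_apply] at hs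
  set U := hX.isHermitian.eigenvectorUnitary
  have h1 : (M * X).trace = ((star U : Matrix n n ℂ) * M * (U : Matrix n n ℂ) *
      diagonal (RCLike.ofReal ∘ hX.isHermitian.eigenvalues)).trace := by
    conv_lhs => rw [hs]
    rw [← mul_assoc, Matrix.trace_mul_comm]
    simp only [mul_assoc]
  rw [h1, hX.isHermitian.trace_eq_sum_eigenvalues]
  refine (norm_trace_mul_diagonal_le _ _).trans ?_
  have h2 : ∑ i, ‖((RCLike.ofReal ∘ hX.isHermitian.eigenvalues) i : ℂ)‖
      = (∑ i, (hX.isHermitian.eigenvalues i : ℂ)).re := by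
    rw [Complex.re_sum]
    refine Finset.sum_congr rfl fun i _ => ?_
    simp [abs_of_nonneg (hX.eigenvalues_nonneg i)]
  rw [h2]
  gcongr
  · rw [← h2]; positivity
  · exact norm_unitary_conj_le U M
  · exact le_rfl

/-- The power `w ^ z` of a real number, set to zero for every exponent when `w ≤ 0`. -/
noncomputable def suppPow (w : ℝ) (z : ℂ) : ℂ := if 0 < w then exp (z * Real.log w) else 0

lemma suppPow_add (w : ℝ) (z z' : ℂ) : suppPow w (z + z') = suppPow w z * suppPow w z' := by
  unfold suppPow
  split_ifs
  · rw [← Complex.exp_add]; ring_nf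
  · simp

lemma norm_suppPow (w : ℝ) (z : ℂ) : ‖suppPow w z‖ = if 0 < w then w ^ z.re else 0 := by
  unfold suppPow
  split_ifs with h
  · rw [Complex.norm_exp, Real.rpow_def_of_pos h]
    simp [mul_comm]
  · simp

lemma suppPow_ofReal (w x : ℝ) : suppPow w x = if 0 < w then ((w ^ x : ℝ) : ℂ) else 0 := by
  unfold suppPow
  split_ifs with h
  · rw [Real.rpow_def_of_pos h]
    push_cast
    rw [mul_comm]
  · rfl

lemma hasDerivAt_suppPow (w : ℝ) (z : ℂ) :
    HasDerivAt (suppPow w) (suppPow w z * Real.log w) z := by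
  unfold suppPow
  split_ifs with h
  · simpa using ((hasDerivAt_id z).mul_const ((Real.log w : ℝ) : ℂ)).cexp
  · simpa using hasDerivAt_const z (0 : ℂ)

/-- The diagonal matrix of powers. -/
noncomputable def diagPow (w : n → ℝ) (z : ℂ) : Matrix n n ℂ := diagonal fun i => suppPow (w i) z

lemma diagPow_add (w : n → ℝ) (z z' : ℂ) : diagPow w (z + z') = diagPow w z * diagPow w z' := by
  simp [diagPow, diagonal_mul_diagonal, suppPow_add]

/-- Imaginary powers are phases on the support of `w` and zero off it, so the matrix is a partial
isometry. -/
lemma norm_diagPow_le_one (w : n → ℝ) {z : ℂ} (hz : z.re = 0) : ‖diagPow w z‖ ≤ 1 := by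
  rw [diagPow, l2_opNorm_diagonal, pi_norm_le_iff_of_nonneg zero_le_one]
  intro i
  rw [norm_suppPow, hz]
  split_ifs <;> simp

/-- The trace of `h w^z Z w^(β - z)`. -/
noncomputable def interpTrace (w : n → ℝ) (h Z : Matrix n n ℂ) (β : ℝ) (z : ℂ) : ℂ :=
  ∑ i, ∑ j, h j i * suppPow (w i) z * Z i j * suppPow (w j) (β - z)

lemma interpTrace_eq_trace (w : n → ℝ) (h Z : Matrix n n ℂ) (β : ℝ) (z : ℂ) :
    interpTrace w h Z β z = (h * diagPow w z * Z * diagPow w (β - z)).trace := by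
  simp only [interpTrace, Matrix.trace, Matrix.diag_apply, diagPow, Matrix.mul_diagonal]
  rw [Finset.sum_comm]
  refine Finset.sum_congr rfl fun j _ => ?_
  rw [Matrix.mul_apply, Finset.sum_mul]
  refine Finset.sum_congr rfl fun i _ => ?_
  rw [Matrix.mul_diagonal]

lemma hasDerivAt_interpTrace (w : n → ℝ) (h Z : Matrix n n ℂ) (β : ℝ) (z : ℂ) :
    HasDerivAt (interpTrace w h Z β)
      (∑ i, ∑ j, h j i * (suppPow (w i) z * Z i j * suppPow (w j) (β - z)) *
        (Real.log (w i) - Real.log (w j))) z := by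
  unfold interpTrace
  refine HasDerivAt.fun_sum fun i _ => HasDerivAt.fun_sum fun j _ => ?_
  have h1 := (hasDerivAt_suppPow (w i) z)
  have h2 : HasDerivAt (fun z : ℂ => suppPow (w j) (β - z))
      (-(suppPow (w j) (β - z) * Real.log (w j))) z := by
    have := (hasDerivAt_suppPow (w j) (β - z)).comp z ((hasDerivAt_id z).const_sub (β : ℂ))
    rw [mul_neg_one] at this
    exact this
  refine (((h1.const_mul (h j i)).mul_const (Z i j)).mul h2).congr_deriv ?_
  ring

lemma differentiable_interpTrace (w : n → ℝ) (h Z : Matrix n n ℂ) (β : ℝ) :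
    Differentiable ℂ (interpTrace w h Z β) :=
  fun z => (hasDerivAt_interpTrace w h Z β z).differentiableAt

lemma norm_suppPow_le_exp (w : ℝ) (z : ℂ) : ‖suppPow w z‖ ≤ Real.exp (|z.re| * |Real.log w|) := by
  rw [norm_suppPow]
  split_ifs with h
  · rw [Real.rpow_def_of_pos h, mul_comm, ← abs_mul]
    exact Real.exp_le_exp.2 (le_abs_self _)
  · positivity

lemma bddAbove_norm_interpTrace (w : n → ℝ) (h Z : Matrix n n ℂ) (β l u : ℝ) :
    BddAbove ((norm ∘ interpTrace w h Z β) '' HadamardThreeLines.verticalClosedStrip l u) := by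
  set B := |l| + |u| + |β| with hB
  refine ⟨∑ i, ∑ j, ‖h j i‖ * Real.exp (B * |Real.log (w i)|) * ‖Z i j‖ *
    Real.exp (B * |Real.log (w j)|), ?_⟩
  rintro _ ⟨z, hz, rfl⟩
  have hz' : l ≤ z.re ∧ z.re ≤ u := hz
  have hz1 : |z.re| ≤ |l| + |u| := by
    rw [abs_le]
    constructor
    · linarith [neg_abs_le l, abs_nonneg u]
    · linarith [le_abs_self u, abs_nonneg l]
  refine (norm_sum_le _ _).trans (Finset.sum_le_sum fun i _ => (norm_sum_le _ _).trans
    (Finset.sum_le_sum fun j _ => ?_))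
  rw [norm_mul, norm_mul, norm_mul]
  have h1 : ‖suppPow (w i) z‖ ≤ Real.exp (B * |Real.log (w i)|) := by
    refine (norm_suppPow_le_exp _ _).trans (Real.exp_le_exp.2 ?_)
    gcongr
    linarith [abs_nonneg β]
  have h2 : ‖suppPow (w j) (β - z)‖ ≤ Real.exp (B * |Real.log (w j)|) := by
    refine (norm_suppPow_le_exp _ _).trans (Real.exp_le_exp.2 ?_)
    gcongr
    have : (β - z : ℂ).re = β - z.re := by simp
    rw [this]
    linarith [abs_sub β z.re]
  gcongr

/-- The trace of the `β`-th power of `diagonal w`. -/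
noncomputable def powSum (w : n → ℝ) (β : ℝ) : ℝ := ∑ i, if 0 < w i then w i ^ β else 0

lemma powSum_nonneg (w : n → ℝ) (β : ℝ) : 0 ≤ powSum w β :=
  Finset.sum_nonneg fun i _ => by split_ifs with h <;> positivity

lemma norm_trace_mul_diagPow_le (w : n → ℝ) (M : Matrix n n ℂ) (β : ℝ) :
    ‖(M * diagPow w β).trace‖ ≤ ‖M‖ * powSum w β := by
  refine (norm_trace_mul_diagonal_le _ _).trans (le_of_eq ?_)
  simp [powSum, norm_suppPow]

/-- Splitting `w^(β-z) = w^(-z) w^β` leaves only contractions around `h` and `Z`, and the positive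
factor `w^β` carries the trace. On the line `Re z = β` the same factor comes out of `w^z` instead.
-/
lemma norm_interpTrace_le_left (w : n → ℝ) (h Z : Matrix n n ℂ) (β : ℝ) {z : ℂ} (hz : z.re = 0) :
    ‖interpTrace w h Z β z‖ ≤ ‖h‖ * (‖Z‖ * powSum w β) := by
  have e : interpTrace w h Z β z
      = ((diagPow w (-z) * h * diagPow w z * Z) * diagPow w β).trace := by
    rw [interpTrace_eq_trace, sub_eq_add_neg, diagPow_add, ← mul_assoc, Matrix.trace_mul_comm]
    simp only [mul_assoc]
  rw [e, ← mul_assoc]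
  refine (norm_trace_mul_diagPow_le _ _ _).trans ?_
  gcongr
  · exact powSum_nonneg _ _
  calc _ ≤ ‖diagPow w (-z)‖ * ‖h‖ * ‖diagPow w z‖ * ‖Z‖ := by
        refine (norm_mul_le _ _).trans ?_
        gcongr
        refine (norm_mul_le _ _).trans ?_
        gcongr
        exact norm_mul_le _ _
    _ ≤ 1 * ‖h‖ * 1 * ‖Z‖ := by
        gcongr
        · exact norm_diagPow_le_one w (by simp [hz])
        · exact norm_diagPow_le_one w hz
    _ = _ := by ring

lemma norm_interpTrace_le_right (w : n → ℝ) (h Z : Matrix n n ℂ) (β : ℝ) {z : ℂ} (hz : z.re = β) :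
    ‖interpTrace w h Z β z‖ ≤ ‖h‖ * (‖Z‖ * powSum w β) := by
  have e : interpTrace w h Z β z
      = ((diagPow w (z - β) * Z * diagPow w (β - z) * h) * diagPow w β).trace := by
    rw [interpTrace_eq_trace]
    conv_lhs => rw [show z = β + (z - β) by ring, diagPow_add]
    rw [Matrix.trace_mul_comm ((diagPow w (z - β) * Z * diagPow w (β - z) * h)),
      show (β - (β + (z - β)) : ℂ) = β - z by ring]
    simp only [mul_assoc]
    rw [Matrix.trace_mul_comm]
    simp only [mul_assoc]
  rw [e, ← mul_assoc]
  refine (norm_trace_mul_diagPow_le _ _ _).trans ?_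
  gcongr
  · exact powSum_nonneg _ _
  calc _ ≤ ‖diagPow w (z - β)‖ * ‖Z‖ * ‖diagPow w (β - z)‖ * ‖h‖ := by
        refine (norm_mul_le _ _).trans ?_
        gcongr
        refine (norm_mul_le _ _).trans ?_
        gcongr
        exact norm_mul_le _ _
    _ ≤ 1 * ‖Z‖ * 1 * ‖h‖ := by
        gcongr
        · exact norm_diagPow_le_one w (by simp [hz])
        · exact norm_diagPow_le_one w (by simp [hz])
    _ = _ := by ring

lemma norm_interpTrace_le (w : n → ℝ) (h Z : Matrix n n ℂ) {β : ℝ} (hβ : 0 < β) {z : ℂ}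
    (h0 : 0 ≤ z.re) (h1 : z.re ≤ β) :
    ‖interpTrace w h Z β z‖ ≤ ‖h‖ * (‖Z‖ * powSum w β) := by
  have key := HadamardThreeLines.norm_le_interp_of_mem_verticalClosedStrip' (l := 0) (u := β)
    (f := interpTrace w h Z β) (z := z) (a := ‖h‖ * (‖Z‖ * powSum w β))
    (b := ‖h‖ * (‖Z‖ * powSum w β)) hβ ⟨h0, h1⟩
    (differentiable_interpTrace w h Z β).diffContOnCl (bddAbove_norm_interpTrace w h Z β 0 β)
    (fun z hz => norm_interpTrace_le_left w h Z β hz)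
    (fun z hz => norm_interpTrace_le_right w h Z β hz)
  have h2 : 0 ≤ ‖h‖ * (‖Z‖ * powSum w β) := by have := powSum_nonneg w β; positivity
  refine key.trans (le_of_eq ?_)
  rw [← Real.rpow_add' h2 (by simp), sub_add_cancel, Real.rpow_one]

/-- The commutator bound for the logarithm: `X = w^(1/2) Z w^(1/2)`. -/
lemma norm_deriv_interpTrace_le (w : n → ℝ) (h Z : Matrix n n ℂ) {K : ℝ}
    (hX : (diagPow w (1 / 2 : ℝ) * Z * diagPow w (1 / 2 : ℝ)).PosSemidef)
    (hX1 : (diagPow w (1 / 2 : ℝ) * Z * diagPow w (1 / 2 : ℝ)).trace.re ≤ 1)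
    (hK : ‖Z‖ * powSum w 1 ≤ K) (hK1 : 1 ≤ Real.log K) :
    ‖deriv (interpTrace w h Z 1) (1 / 2)‖ ≤ ‖h‖ * (2 * Real.exp 1 * Real.log K) := by
  have hK0 : 0 < K := by
    rcases lt_trichotomy K 0 with h | h | h
    · have := powSum_nonneg w 1
      have : 0 ≤ ‖Z‖ * powSum w 1 := by positivity
      linarith
    · simp [h] at hK1; linarith
    · exact h
  -- On the middle line the real parts of both powers rebuild `X`; the imaginary powers only
  -- conjugate `h`. The bound uses `Tr X ≤ 1` and is free of `K`.
  have hmid : ∀ z : ℂ, z.re = 1 / 2 → ‖interpTrace w h Z 1 z‖ ≤ ‖h‖ := by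
    intro z hz
    have e : interpTrace w h Z 1 z = ((diagPow w (1 / 2 - z) * h * diagPow w (z - 1 / 2)) *
        (diagPow w (1 / 2 : ℝ) * Z * diagPow w (1 / 2 : ℝ))).trace := by
      rw [interpTrace_eq_trace]
      conv_lhs => rw [show (((1 : ℝ) : ℂ) - z) = (1 / 2 : ℝ) + (1 / 2 - z) by push_cast; ring,
        show diagPow w z = diagPow w ((z - 1 / 2) + (1 / 2 : ℝ)) by congr 1; push_cast; ring,
        diagPow_add, diagPow_add, ← mul_assoc, Matrix.trace_mul_comm]
      simp only [mul_assoc]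
    rw [e]
    refine (norm_trace_mul_posSemidef_le _ hX).trans ?_
    have hM : ‖diagPow w (1 / 2 - z) * h * diagPow w (z - 1 / 2)‖ ≤ ‖h‖ :=
      calc _ ≤ ‖diagPow w (1 / 2 - z)‖ * ‖h‖ * ‖diagPow w (z - 1 / 2)‖ := by
            refine (norm_mul_le _ _).trans ?_
            gcongr
            exact norm_mul_le _ _
        _ ≤ 1 * ‖h‖ * 1 := by
            gcongr
            · exact norm_diagPow_le_one w (by simp [hz])
            · exact norm_diagPow_le_one w (by simp [hz])
        _ = ‖h‖ := by ring
    have hX0 : 0 ≤ (diagPow w (1 / 2 : ℝ) * Z * diagPow w (1 / 2 : ℝ)).trace.re :=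
      (Complex.le_def.1 hX.trace_nonneg).1
    calc _ ≤ ‖h‖ * 1 := mul_le_mul hM hX1 hX0 (norm_nonneg _)
      _ = ‖h‖ := mul_one _
  have hl : ∀ z : ℂ, z.re = 0 → ‖interpTrace w h Z 1 z‖ ≤ ‖h‖ * K := fun z hz =>
    (norm_interpTrace_le_left w h Z 1 hz).trans (by gcongr)
  have hr : ∀ z : ℂ, z.re = 1 → ‖interpTrace w h Z 1 z‖ ≤ ‖h‖ * K := fun z hz =>
    (norm_interpTrace_le_right w h Z 1 hz).trans (by gcongr)
  have hd := differentiable_interpTrace w h Z 1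
  have hp : ∀ s : ℝ, 0 ≤ s → s ≤ 1 → ‖h‖ ^ (1 - s) * (‖h‖ * K) ^ s = ‖h‖ * K ^ s := by
    intro s _ _
    rw [Real.mul_rpow (norm_nonneg _) hK0.le, ← mul_assoc, ← Real.rpow_add' (norm_nonneg _) (by simp),
      sub_add_cancel, Real.rpow_one]
  -- Three lines on each half strip separately, so that the exponent of `K` vanishes at the middle
  -- line.
  have hstrip : ∀ z : ℂ, |z.re - 1 / 2| ≤ 1 / 2 →
      ‖interpTrace w h Z 1 z‖ ≤ ‖h‖ * K ^ (2 * |z.re - 1 / 2|) := by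
    intro z hz
    rw [abs_le] at hz
    rcases le_total (1 / 2) z.re with hc | hc
    · have key := HadamardThreeLines.norm_le_interp_of_mem_verticalClosedStrip' (l := 1 / 2)
        (u := 1) (f := interpTrace w h Z 1) (z := z) (by norm_num) ⟨hc, by linarith⟩
        hd.diffContOnCl (bddAbove_norm_interpTrace w h Z 1 _ _)
        (fun z hz => hmid z hz) (fun z hz => hr z hz)
      rw [abs_of_nonneg (by linarith)]
      have e : (z.re - 1 / 2) / (1 - 1 / 2) = 2 * (z.re - 1 / 2) := by ring
      rw [e, hp _ (by linarith) (by linarith)] at key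
      exact key
    · have key := HadamardThreeLines.norm_le_interp_of_mem_verticalClosedStrip' (l := 0)
        (u := 1 / 2) (f := interpTrace w h Z 1) (z := z) (by norm_num) ⟨by linarith, hc⟩
        hd.diffContOnCl (bddAbove_norm_interpTrace w h Z 1 _ _)
        (fun z hz => hl z hz) (fun z hz => hmid z hz)
      rw [abs_of_nonpos (by linarith)]
      have e : (z.re - 0) / (1 / 2 - 0) = 1 - 2 * -(z.re - 1 / 2) := by ring
      have hp' := hp (2 * -(z.re - 1 / 2)) (by linarith) (by linarith)
      rw [e, sub_sub_cancel, mul_comm, hp'] at key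
      exact key
  -- With this radius `K^(2r) = e`, and `1 ≤ log K` keeps the disc inside the strip.
  set r : ℝ := 1 / (2 * Real.log K) with hr_def
  have hlog : 0 < Real.log K := by linarith
  have hr0 : 0 < r := by positivity
  have hr1 : r ≤ 1 / 2 := by
    rw [hr_def]
    apply one_div_le_one_div_of_le <;> linarith
  have hK1' : 1 ≤ K := by
    by_contra hlt
    have := Real.log_nonpos hK0.le (not_le.1 hlt).le
    linarith
  have hcau := Complex.norm_deriv_le_of_forall_mem_sphere_norm_le (c := (1 / 2 : ℂ)) (R := r)
    (C := ‖h‖ * Real.exp 1) hr0 hd.diffContOnCl (f := interpTrace w h Z 1) (by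
      intro z hz
      have h1 : |z.re - 1 / 2| ≤ r := by
        have h2 := Complex.abs_re_le_norm (z - 1 / 2)
        rw [mem_sphere_iff_norm] at hz
        rw [hz] at h2
        simpa using h2
      refine (hstrip z (h1.trans hr1)).trans ?_
      gcongr
      calc K ^ (2 * |z.re - 1 / 2|) ≤ K ^ (2 * r) := by gcongr
        _ = Real.exp 1 := by
          rw [Real.rpow_def_of_pos hK0, hr_def]
          congr 1
          field_simp)
  refine hcau.trans (le_of_eq ?_)
  rw [hr_def]
  field_simp

end Interpolation

/-! ### Commutators with functions of a dominating diagonal matrix -/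

section Commutator

open Matrix Complex
open scoped Matrix.Norms.L2Operator ComplexOrder Kronecker

variable {n : Type*} [Fintype n] [DecidableEq n]

lemma posSemidef_row_eq_zero {X : Matrix n n ℂ} (hX : X.PosSemidef) {i : n} (hi : X i i = 0)
    (j : n) : X i j = 0 := by
  have h := (hX.dotProduct_mulVec_zero_iff (Pi.single i 1)).1 (by simp [hi])
  have h2 : X j i = 0 := by simpa using congrFun h j
  rw [← hX.isHermitian.apply i j, h2, star_zero]

/-- Domination forces the diagonal of `X` to vanish wherever `w` does, and positivity then kills the
whole row and column. Thus `X` lives on the support of `w`, and the convention of `suppPow` for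
nonpositive numbers loses nothing. -/
lemma entry_eq_zero_of_dominated {w : n → ℝ} (hw : ∀ i, 0 ≤ w i) {X : Matrix n n ℂ}
    (hX : X.PosSemidef) {D : ℝ}
    (hD : ((D : ℂ) • diagonal (fun i => (w i : ℂ)) - X).PosSemidef) {i j : n}
    (h : ¬ (0 < w i ∧ 0 < w j)) : X i j = 0 := by
  have key : ∀ i, ¬ 0 < w i → ∀ j, X i j = 0 := by
    intro i hi
    have hi0 : w i = 0 := le_antisymm (not_lt.1 hi) (hw i)
    refine posSemidef_row_eq_zero hX (le_antisymm ?_ (hX.diag_nonneg))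
    have := hD.diag_nonneg (i := i)
    simpa [hi0] using this
  by_cases hi : 0 < w i
  · have hj : ¬ 0 < w j := fun hj => h ⟨hi, hj⟩
    rw [← hX.isHermitian.apply i j, key j hj i, star_zero]
  · exact key i hi j

/-- The matrix `w^(-1/2) X w^(-1/2)`. -/
noncomputable def sandwich (w : n → ℝ) (X : Matrix n n ℂ) : Matrix n n ℂ :=
  diagPow w (-(1 / 2) : ℝ) * X * diagPow w (-(1 / 2) : ℝ)

lemma diagPow_half_mul_sandwich {w : n → ℝ} (hw : ∀ i, 0 ≤ w i) {X : Matrix n n ℂ}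
    (hX : X.PosSemidef) {D : ℝ}
    (hD : ((D : ℂ) • diagonal (fun i => (w i : ℂ)) - X).PosSemidef) :
    diagPow w (1 / 2 : ℝ) * sandwich w X * diagPow w (1 / 2 : ℝ) = X := by
  have e1 : diagPow w (1 / 2 : ℝ) * diagPow w (-(1 / 2) : ℝ) = diagPow w 0 := by
    rw [← diagPow_add]; congr 1; push_cast; ring
  have e2 : diagPow w (-(1 / 2) : ℝ) * diagPow w (1 / 2 : ℝ) = diagPow w 0 := by
    rw [← diagPow_add]; congr 1; push_cast; ring
  have e3 : diagPow w (1 / 2 : ℝ) * sandwich w X * diagPow w (1 / 2 : ℝ)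
      = diagPow w 0 * X * diagPow w 0 := by
    rw [← e1, sandwich]
    simp only [mul_assoc]
    rw [e1, e2]
  rw [e3]
  ext i j
  simp only [diagPow, Matrix.mul_diagonal, Matrix.diagonal_mul]
  by_cases h : 0 < w i ∧ 0 < w j
  · simp [suppPow, h.1, h.2]
  · rw [entry_eq_zero_of_dominated hw hX hD h]; simp

lemma conjTranspose_diagPow (w : n → ℝ) (x : ℝ) : (diagPow w x)ᴴ = diagPow w x := by
  rw [diagPow, diagonal_conjTranspose]
  congr 1
  ext i
  simp only [Pi.star_apply, suppPow_ofReal]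
  split_ifs <;> simp

open scoped MatrixOrder in
lemma norm_le_of_posSemidef {Z : Matrix n n ℂ} {D : ℝ} (h0 : 0 ≤ D) (hZ : Z.PosSemidef)
    (hD : ((D : ℂ) • (1 : Matrix n n ℂ) - Z).PosSemidef) : ‖Z‖ ≤ D := by
  rw [CStarAlgebra.norm_le_iff_le_algebraMap Z h0 hZ.nonneg, Matrix.le_iff]
  have e : algebraMap ℝ (Matrix n n ℂ) D = (D : ℂ) • (1 : Matrix n n ℂ) := by
    rw [Algebra.algebraMap_eq_smul_one]
    ext i j
    simp
  rw [e]
  exact hD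

lemma norm_sandwich_le {w : n → ℝ} {X : Matrix n n ℂ}
    (hX : X.PosSemidef) {D : ℝ} (h0 : 0 ≤ D)
    (hD : ((D : ℂ) • diagonal (fun i => (w i : ℂ)) - X).PosSemidef) : ‖sandwich w X‖ ≤ D := by
  have hc := conjTranspose_diagPow w (-(1 / 2))
  refine norm_le_of_posSemidef h0 ?_ ?_
  · have := hX.conjTranspose_mul_mul_same (diagPow w (-(1 / 2) : ℝ))
    rwa [hc] at this
  · have h1 := hD.conjTranspose_mul_mul_same (diagPow w (-(1 / 2) : ℝ))
    rw [hc, mul_sub, sub_mul] at h1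
    -- Conjugating `D w - X` gives `D` only on the support of `w`; this matrix supplies the missing
    -- part of `D • 1`.
    have h2 : (diagonal (fun i => if 0 < w i then (0 : ℂ) else D)).PosSemidef := by
      refine PosSemidef.diagonal fun i => ?_
      simp only [Pi.zero_apply]
      split_ifs
      · exact le_rfl
      · exact_mod_cast h0
    have h3 := h1.add h2
    convert h3 using 1
    rw [sub_add_eq_add_sub]
    congr 1
    rw [Matrix.mul_smul, Matrix.smul_mul, diagPow, diagonal_mul_diagonal, diagonal_mul_diagonal,
      ← diagonal_smul, diagonal_add, ← diagonal_one, ← diagonal_smul]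
    congr 1
    ext i
    simp only [Pi.smul_apply, smul_eq_mul, mul_one, suppPow_ofReal]
    split_ifs with hi
    · have : w i ^ (-(1 / 2) : ℝ) * w i * w i ^ (-(1 / 2) : ℝ) = 1 := by
        rw [← Real.rpow_add_one hi.ne', ← Real.rpow_add hi]
        norm_num
      rw [← ofReal_mul, ← ofReal_mul, this]; simp
    · simp

lemma trace_mul_commutator_diagonal (h X : Matrix n n ℂ) (g : n → ℂ) :
    (h * (X * diagonal g - diagonal g * X)).trace = ∑ i, ∑ j, h j i * X i j * (g j - g i) := by
  simp only [Matrix.trace, Matrix.diag_apply, Matrix.mul_apply (M := h), Matrix.sub_apply,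
    Matrix.mul_diagonal, Matrix.diagonal_mul]
  rw [Finset.sum_comm]
  refine Finset.sum_congr rfl fun i _ => Finset.sum_congr rfl fun j _ => ?_
  ring

/-- The derivative of `w_i^z w_j^(1-z)` brings down `log w_i - log w_j`, which is the difference of
the diagonal entries in the commutator; the constant `-1` cancels. Hence the trace is the derivative
of `interpTrace` at `1/2`. -/
lemma norm_trace_commutator_log_le {w : n → ℝ} (hw : ∀ i, 0 ≤ w i) {X : Matrix n n ℂ}
    (hX : X.PosSemidef) (hX1 : X.trace.re ≤ 1) {D K : ℝ} (h0 : 0 ≤ D)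
    (hD : ((D : ℂ) • diagonal (fun i => (w i : ℂ)) - X).PosSemidef)
    (hK : D * ∑ i, w i ≤ K) (hK1 : 1 ≤ Real.log K) (h : Matrix n n ℂ) :
    ‖(h * (X * diagonal (fun i => ((if w i = 0 then 0 else -Real.log (w i) - 1 : ℝ) : ℂ)) -
      diagonal (fun i => ((if w i = 0 then 0 else -Real.log (w i) - 1 : ℝ) : ℂ)) * X)).trace‖
      ≤ ‖h‖ * (2 * Real.exp 1 * Real.log K) := by
  have hs := diagPow_half_mul_sandwich hw hX hD
  have hp : powSum w 1 = ∑ i, w i := by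
    refine Finset.sum_congr rfl fun i _ => ?_
    split_ifs with hi
    · simp
    · exact le_antisymm (hw i) (not_lt.1 hi)
  have key := norm_deriv_interpTrace_le w h (sandwich w X) (K := K) (hs.symm ▸ hX)
    (hs.symm ▸ hX1) (by
      refine le_trans ?_ hK
      rw [hp]
      gcongr
      · exact Finset.sum_nonneg fun i _ => hw i
      · exact norm_sandwich_le hX h0 hD) hK1
  rw [(hasDerivAt_interpTrace w h (sandwich w X) 1 (1 / 2)).deriv] at key
  convert key using 2
  rw [trace_mul_commutator_diagonal]
  refine Finset.sum_congr rfl fun i _ => Finset.sum_congr rfl fun j _ => ?_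
  have he : suppPow (w i) (1 / 2) * sandwich w X i j * suppPow (w j) ((1 : ℝ) - 1 / 2) = X i j := by
    conv_rhs => rw [← hs]
    simp only [diagPow, Matrix.mul_diagonal, Matrix.diagonal_mul]
    congr 3 <;> push_cast <;> ring
  rw [he]
  by_cases hij : 0 < w i ∧ 0 < w j
  · rw [if_neg hij.1.ne', if_neg hij.2.ne']
    push_cast
    ring
  · rw [entry_eq_zero_of_dominated hw hX hD hij]; simp

lemma norm_trace_commutator_rpow_le {w : n → ℝ} (hw : ∀ i, 0 ≤ w i) {X : Matrix n n ℂ}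
    (hX : X.PosSemidef) {D α : ℝ} (h0 : 0 ≤ D) (hα : 1 / 2 ≤ α)
    (hD : ((D : ℂ) • diagonal (fun i => (w i : ℂ)) - X).PosSemidef) (h : Matrix n n ℂ) :
    ‖(h * (X * diagonal (fun i => ((if w i = 0 then 0 else α * w i ^ (α - 1) : ℝ) : ℂ)) -
      diagonal (fun i => ((if w i = 0 then 0 else α * w i ^ (α - 1) : ℝ) : ℂ)) * X)).trace‖
      ≤ ‖h‖ * (2 * α * D * ∑ i, w i ^ α) := by
  have hs := diagPow_half_mul_sandwich hw hX hD
  have hα0 : 0 < α := by linarith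
  have hp : powSum w α = ∑ i, w i ^ α := by
    refine Finset.sum_congr rfl fun i _ => ?_
    split_ifs with hi
    · rfl
    · rw [le_antisymm (not_lt.1 hi) (hw i), Real.zero_rpow hα0.ne']
  -- At `z = 1/2` the surplus power `w^(α-1)` sits to the right of `X`, at `z = α - 1/2` to its
  -- left. Both points lie in `[0, α]` because `1/2 ≤ α`.
  have e : (h * (X * diagonal (fun i => ((if w i = 0 then 0 else α * w i ^ (α - 1) : ℝ) : ℂ)) -
      diagonal (fun i => ((if w i = 0 then 0 else α * w i ^ (α - 1) : ℝ) : ℂ)) * X)).trace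
      = α * (interpTrace w h (sandwich w X) α (1 / 2) -
        interpTrace w h (sandwich w X) α (α - 1 / 2)) := by
    rw [trace_mul_commutator_diagonal, interpTrace, interpTrace, ← Finset.sum_sub_distrib,
      Finset.mul_sum]
    refine Finset.sum_congr rfl fun i _ => ?_
    rw [← Finset.sum_sub_distrib, Finset.mul_sum]
    refine Finset.sum_congr rfl fun j _ => ?_
    have he : suppPow (w i) (1 / 2 : ℝ) * sandwich w X i j * suppPow (w j) (1 / 2 : ℝ) = X i j := by
      conv_rhs => rw [← hs]
      simp only [diagPow, Matrix.mul_diagonal, Matrix.diagonal_mul]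
    have hg : ∀ x : ℝ, 0 < x → ((α * x ^ (α - 1) : ℝ) : ℂ) = α * suppPow x ((α - 1 : ℝ)) := by
      intro x hx
      rw [suppPow_ofReal, if_pos hx]; push_cast; rfl
    by_cases hij : 0 < w i ∧ 0 < w j
    · rw [if_neg hij.1.ne', if_neg hij.2.ne', hg _ hij.1, hg _ hij.2,
        show (α - 1 / 2 : ℂ) = (1 / 2 : ℝ) + (α - 1 : ℝ) by push_cast; ring,
        show (α - ((1 / 2 : ℝ) + (α - 1 : ℝ)) : ℂ) = (1 / 2 : ℝ) by push_cast; ring,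
        suppPow_add, suppPow_add, ← he, show (1 / 2 : ℂ) = (1 / 2 : ℝ) by push_cast; ring]
      ring
    · have hz := entry_eq_zero_of_dominated hw hX hD hij
      have : sandwich w X i j = 0 := by
        simp [sandwich, diagPow, Matrix.mul_diagonal, Matrix.diagonal_mul, hz]
      simp [hz, this]
  rw [e, norm_mul, norm_real, Real.norm_of_nonneg hα0.le]
  have hb : ‖sandwich w X‖ * powSum w α ≤ D * ∑ i, w i ^ α := by
    rw [← hp]
    gcongr
    · exact powSum_nonneg _ _
    · exact norm_sandwich_le hX h0 hD
  have h1 : ‖interpTrace w h (sandwich w X) α (1 / 2)‖ ≤ ‖h‖ * (D * ∑ i, w i ^ α) :=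
    (norm_interpTrace_le w h _ hα0 (by norm_num) (by norm_num; linarith)).trans (by gcongr)
  have h2 : ‖interpTrace w h (sandwich w X) α (α - 1 / 2)‖ ≤ ‖h‖ * (D * ∑ i, w i ^ α) :=
    (norm_interpTrace_le w h _ hα0 (by norm_num; linarith) (by norm_num)).trans (by gcongr)
  calc _ ≤ α * (‖h‖ * (D * ∑ i, w i ^ α) + ‖h‖ * (D * ∑ i, w i ^ α)) := by
        gcongr
        exact (norm_sub_le _ _).trans (add_le_add h1 h2)
    _ = _ := by ring

end Commutator

/-! ### Partial traces, the pinching inequality and the commutator bounds for reduced states -/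

section PartialTrace

open Matrix Complex
open scoped Matrix.Norms.L2Operator ComplexOrder Kronecker

section Conj

variable {n : Type*} [Fintype n] [DecidableEq n]

lemma trace_mul_commutator_conj (V : Matrix.unitaryGroup n ℂ) (h X : Matrix n n ℂ) (g : n → ℂ) :
    (h * (X * ((V : Matrix n n ℂ) * diagonal g * (star V : Matrix n n ℂ)) -
      ((V : Matrix n n ℂ) * diagonal g * (star V : Matrix n n ℂ)) * X)).trace =
    (((star V : Matrix n n ℂ) * h * V) * (((star V : Matrix n n ℂ) * X * V) * diagonal g -
      diagonal g * ((star V : Matrix n n ℂ) * X * V))).trace := by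
  have hV : (V : Matrix n n ℂ) * (star V : Matrix n n ℂ) = 1 := Unitary.coe_mul_star_self V
  have hV' : ∀ M : Matrix n n ℂ, (V : Matrix n n ℂ) * ((star V : Matrix n n ℂ) * M) = M := by
    intro M; rw [← mul_assoc, hV, one_mul]
  rw [mul_sub, mul_sub, trace_sub, trace_sub]
  congr 1
  · have : (star V : Matrix n n ℂ) * h * V * ((star V : Matrix n n ℂ) * X * V * diagonal g)
        = (star V : Matrix n n ℂ) * (h * X * V * diagonal g) := by
      simp only [mul_assoc, hV']
    rw [this, Matrix.trace_mul_comm (star V : Matrix n n ℂ)]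
    simp only [mul_assoc]
  · have : (star V : Matrix n n ℂ) * h * V * (diagonal g * ((star V : Matrix n n ℂ) * X * V))
        = (star V : Matrix n n ℂ) * (h * V * diagonal g * (star V : Matrix n n ℂ) * X * V) := by
      simp only [mul_assoc]
    rw [this, Matrix.trace_mul_comm (star V : Matrix n n ℂ)]
    simp only [mul_assoc, hV, mul_one]

lemma trace_conj_unitary (V : Matrix.unitaryGroup n ℂ) (X : Matrix n n ℂ) :
    ((star V : Matrix n n ℂ) * X * V).trace = X.trace := by
  have hV : (V : Matrix n n ℂ) * (star V : Matrix n n ℂ) = 1 := Unitary.coe_mul_star_self V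
  rw [Matrix.trace_mul_comm, ← mul_assoc, hV, one_mul]

lemma posSemidef_conj_unitary (V : Matrix.unitaryGroup n ℂ) {X : Matrix n n ℂ}
    (hX : X.PosSemidef) : ((star V : Matrix n n ℂ) * X * V).PosSemidef :=
  hX.conjTranspose_mul_mul_same (V : Matrix n n ℂ)

lemma dominated_conj_unitary (V : Matrix.unitaryGroup n ℂ) {X : Matrix n n ℂ} {D : ℝ} {w : n → ℝ}
    (hD : ((D : ℂ) • ((V : Matrix n n ℂ) * diagonal (fun i => (w i : ℂ)) *
      (star V : Matrix n n ℂ)) - X).PosSemidef) :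
    ((D : ℂ) • diagonal (fun i => (w i : ℂ)) - (star V : Matrix n n ℂ) * X * V).PosSemidef := by
  have hV : (star V : Matrix n n ℂ) * (V : Matrix n n ℂ) = 1 := Unitary.coe_star_mul_self V
  have h := posSemidef_conj_unitary V hD
  convert h using 1
  rw [mul_sub, sub_mul, Matrix.mul_smul, Matrix.smul_mul]
  congr 2
  simp only [mul_assoc, hV, mul_one]
  rw [← mul_assoc, hV, one_mul]

end Conj

variable {a b r : Type*} [Fintype a] [DecidableEq a] [Fintype b] [DecidableEq b] [Fintype r]
  [DecidableEq r]

/-- The partial trace over the second factor. -/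
def partialTrace (M : Matrix (a × b) (a × b) ℂ) : Matrix a a ℂ :=
  fun i j => ∑ x, M (i, x) (j, x)

lemma partialTrace_sub (M N : Matrix (a × b) (a × b) ℂ) :
    partialTrace (M - N) = partialTrace M - partialTrace N := by
  ext i j; simp [partialTrace]

lemma partialTrace_kronecker_one_mul (G : Matrix a a ℂ) (N : Matrix (a × b) (a × b) ℂ) :
    partialTrace ((G ⊗ₖ (1 : Matrix b b ℂ)) * N) = G * partialTrace N := by
  ext i j
  simp only [partialTrace, Matrix.mul_apply, Fintype.sum_prod_type, kroneckerMap_apply,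
    Matrix.one_apply, mul_ite, mul_one, mul_zero, ite_mul, zero_mul, Finset.sum_ite_eq,
    Finset.mem_univ, if_true, Finset.mul_sum]
  rw [Finset.sum_comm]

lemma partialTrace_mul_kronecker_one (G : Matrix a a ℂ) (N : Matrix (a × b) (a × b) ℂ) :
    partialTrace (N * (G ⊗ₖ (1 : Matrix b b ℂ))) = partialTrace N * G := by
  ext i j
  simp only [partialTrace, Matrix.mul_apply, Fintype.sum_prod_type, kroneckerMap_apply,
    Matrix.one_apply, mul_ite, mul_one, mul_zero, Finset.sum_ite_eq',
    Finset.mem_univ, if_true, Finset.sum_mul]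
  rw [Finset.sum_comm]

lemma trace_partialTrace (M : Matrix (a × b) (a × b) ℂ) : (partialTrace M).trace = M.trace := by
  simp [Matrix.trace, partialTrace, Fintype.sum_prod_type]

lemma trace_mul_partialTrace (G : Matrix a a ℂ) (N : Matrix (a × b) (a × b) ℂ) :
    (G * partialTrace N).trace = ((G ⊗ₖ (1 : Matrix b b ℂ)) * N).trace := by
  rw [← partialTrace_kronecker_one_mul, trace_partialTrace]

lemma posSemidef_partialTrace {M : Matrix (a × b) (a × b) ℂ} (hM : M.PosSemidef) :
    (partialTrace M).PosSemidef := by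
  have : partialTrace M = ∑ x, M.submatrix (fun i => (i, x)) (fun i => (i, x)) := by
    ext i j
    simp [partialTrace, Matrix.sum_apply]
  rw [this]
  exact posSemidef_sum _ fun x _ => hM.submatrix _

/-- Let `E_z` be the projection onto the basis vector `z` of the second factor. The pinching of `X`
satisfies `D ∑ E_z X E_z - X = ½ ∑ (E_y - E_z) X (E_y - E_z)`, which is positive. What remains, `D ∑
X_zz ⊗ (1 - |z⟩⟨z|)` with `X_zz` the diagonal blocks, is positive as well. -/
lemma posSemidef_card_smul_partialTrace_sub {X : Matrix (a × b) (a × b) ℂ} (hX : X.PosSemidef) :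
    (((Fintype.card b : ℝ) : ℂ) • (partialTrace X ⊗ₖ (1 : Matrix b b ℂ)) - X).PosSemidef := by
  have h1 : ∀ z : b, ((X.submatrix (fun i => (i, z)) (fun i => (i, z))) ⊗ₖ
      (diagonal (fun x : b => if x = z then (0 : ℂ) else 1))).PosSemidef := fun z => by
    refine (hX.submatrix _).kronecker (PosSemidef.diagonal fun x => ?_)
    simp only [Pi.zero_apply]
    split_ifs <;> simp
  have h2 : ∀ y z : b, (diagonal (fun p : a × b => (if p.2 = y then (1 : ℂ) else 0) -
      (if p.2 = z then 1 else 0)) * X * (diagonal (fun p : a × b => (if p.2 = y then (1 : ℂ) else 0) -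
      (if p.2 = z then 1 else 0)))ᴴ).PosSemidef := fun y z => hX.mul_mul_conjTranspose_same _
  have h3 := ((posSemidef_sum Finset.univ fun z _ => h1 z).smul
    (show (0 : ℂ) ≤ ((Fintype.card b : ℝ) : ℂ) by exact_mod_cast Nat.zero_le _)).add
    ((posSemidef_sum Finset.univ fun y _ => posSemidef_sum Finset.univ fun z _ => h2 y z).smul
      (show (0 : ℂ) ≤ ((1 / 2 : ℝ) : ℂ) by exact_mod_cast (by norm_num)))
  convert h3 using 1
  ext ⟨i, x⟩ ⟨j, y⟩
  simp only [Matrix.sub_apply, Matrix.smul_apply, Matrix.add_apply, Matrix.sum_apply,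
    kroneckerMap_apply, diagonal_conjTranspose, Matrix.mul_diagonal, Matrix.diagonal_mul,
    Matrix.submatrix_apply, Pi.star_apply, star_sub, partialTrace, smul_eq_mul]
  have e1 : ∀ u v : b, ((if x = u then (1 : ℂ) else 0) - if x = v then 1 else 0) * X (i, x) (j, y) *
      (star (if y = u then (1 : ℂ) else 0) - star (if y = v then (1 : ℂ) else 0)) =
      (((if x = u then (if y = u then 1 else 0) else 0) -
        (if x = u then 1 else 0) * (if y = v then 1 else 0)
        - (if y = u then 1 else 0) * (if x = v then 1 else 0)) +
        (if x = v then (if y = v then 1 else 0) else 0)) * X (i, x) (j, y) := by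
    intro u v
    have hs : ∀ p : Prop, [Decidable p] → star (if p then (1 : ℂ) else 0) = if p then 1 else 0 := by
      intro p _; split_ifs <;> simp
    rw [hs, hs]
    split_ifs <;> ring
  simp only [e1, ← Finset.sum_mul, Finset.sum_add_distrib, Finset.sum_sub_distrib,
    ← Finset.mul_sum, Finset.sum_ite_eq, Finset.mem_univ, if_true, Finset.sum_const,
    Finset.card_univ, nsmul_eq_mul]
  by_cases hxy : x = y
  · subst hxy
    simp only [Matrix.one_apply_eq, diagonal_apply_eq, mul_one, if_true, mul_ite, mul_zero]
    rw [Finset.sum_ite, Finset.sum_const_zero, zero_add, Finset.filter_not, Finset.filter_eq]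
    simp only [Finset.mem_univ, if_true]
    rw [Finset.sum_sdiff_eq_sub (Finset.subset_univ _), Finset.sum_singleton]
    push_cast
    ring
  · simp [Matrix.one_apply_ne hxy, diagonal_apply_ne _ hxy, Ne.symm hxy]
    ring

/-- Tracing out `r` passes through `h ⊗ 1`, tracing out `b` is dual to `G ↦ G ⊗ 1`, and cyclicity
moves the commutator from `h` onto `G`. The system `r`, of arbitrary size, disappears. -/
lemma trace_mul_partialTrace_commutator (G : Matrix a a ℂ) (h : Matrix (a × b) (a × b) ℂ)
    (ρ : Matrix ((a × b) × r) ((a × b) × r) ℂ) :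
    (G * partialTrace (partialTrace ((h ⊗ₖ (1 : Matrix r r ℂ)) * ρ -
      ρ * (h ⊗ₖ (1 : Matrix r r ℂ))))).trace =
    (h * (partialTrace ρ * (G ⊗ₖ (1 : Matrix b b ℂ)) -
      (G ⊗ₖ (1 : Matrix b b ℂ)) * partialTrace ρ)).trace := by
  rw [partialTrace_sub, partialTrace_kronecker_one_mul, partialTrace_mul_kronecker_one,
    trace_mul_partialTrace, mul_sub, mul_sub, trace_sub, trace_sub]
  congr 1
  · rw [Matrix.trace_mul_comm, mul_assoc]
  · rw [← mul_assoc, Matrix.trace_mul_comm]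

/-- The unitary `U ⊗ 1`. -/
noncomputable def unitaryKronOne (U : Matrix.unitaryGroup a ℂ) : Matrix.unitaryGroup (a × b) ℂ :=
  ⟨(U : Matrix a a ℂ) ⊗ₖ (1 : Matrix b b ℂ), kronecker_mem_unitary U.2 (one_mem _)⟩

lemma conj_unitaryKronOne (U : Matrix.unitaryGroup a ℂ) (g : a → ℂ) :
    ((U : Matrix a a ℂ) * diagonal g * (star U : Matrix a a ℂ)) ⊗ₖ (1 : Matrix b b ℂ) =
    (unitaryKronOne (b := b) U : Matrix (a × b) (a × b) ℂ) * diagonal (fun p : a × b => g p.1) *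
      (star (unitaryKronOne (b := b) U) : Matrix (a × b) (a × b) ℂ) := by
  have h1 : diagonal (fun p : a × b => g p.1) = diagonal g ⊗ₖ (1 : Matrix b b ℂ) := by
    rw [← diagonal_one, diagonal_kronecker_diagonal]; simp
  have h2 : (star (unitaryKronOne (b := b) U) : Matrix (a × b) (a × b) ℂ)
      = (star U : Matrix a a ℂ) ⊗ₖ (1 : Matrix b b ℂ) := by
    change ((U : Matrix a a ℂ) ⊗ₖ (1 : Matrix b b ℂ))ᴴ = _
    rw [conjTranspose_kronecker, conjTranspose_one]
    rfl
  rw [h1, h2, unitaryKronOne]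
  simp only
  rw [← mul_kronecker_mul, ← mul_kronecker_mul, one_mul, one_mul]

lemma cfc_eq_conj {R : Matrix a a ℂ} (hR : R.IsHermitian) (g : ℝ → ℝ) :
    cfc g R = (hR.eigenvectorUnitary : Matrix a a ℂ) *
      diagonal (fun i => ((g (hR.eigenvalues i) : ℝ) : ℂ)) *
      (star hR.eigenvectorUnitary : Matrix a a ℂ) := by
  rw [hR.cfc_eq, IsHermitian.cfc, Unitary.conjStarAlgAut_apply]
  rfl

lemma eq_conj_eigenvalues {R : Matrix a a ℂ} (hR : R.IsHermitian) :
    R = (hR.eigenvectorUnitary : Matrix a a ℂ) * diagonal (fun i => (hR.eigenvalues i : ℂ)) *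
      (star hR.eigenvectorUnitary : Matrix a a ℂ) := by
  have := hR.spectral_theorem
  rw [Unitary.conjStarAlgAut_apply] at this
  exact this

lemma trace_cfc_re {R : Matrix a a ℂ} (hR : R.IsHermitian) (g : ℝ → ℝ) :
    (cfc g R).trace.re = ∑ i, g (hR.eigenvalues i) := by
  rw [cfc_eq_conj hR, Matrix.trace_mul_comm, ← mul_assoc, Unitary.coe_star_mul_self, one_mul,
    trace_diagonal, Complex.re_sum]
  rfl

variable {X : Matrix (a × b) (a × b) ℂ}

lemma dominated_partialTrace (hX : X.PosSemidef) (hR : (partialTrace X).IsHermitian) :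
    ((((Fintype.card b : ℝ) : ℝ) : ℂ) • diagonal (fun i : a × b => (hR.eigenvalues i.1 : ℂ)) -
      (star (unitaryKronOne (b := b) hR.eigenvectorUnitary) : Matrix (a × b) (a × b) ℂ) * X *
        unitaryKronOne (b := b) hR.eigenvectorUnitary).PosSemidef := by
  refine dominated_conj_unitary (w := fun i : a × b => hR.eigenvalues i.1) _ ?_
  have h := posSemidef_card_smul_partialTrace_sub hX
  rw [eq_conj_eigenvalues hR, conj_unitaryKronOne hR.eigenvectorUnitary
    (fun i => (hR.eigenvalues i : ℂ))] at h
  exact h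

lemma sum_eigenvalues_eq_trace_re {R : Matrix a a ℂ} (hR : R.IsHermitian) :
    ∑ i, hR.eigenvalues i = R.trace.re := by
  rw [hR.trace_eq_sum_eigenvalues, Complex.re_sum]
  rfl

lemma norm_trace_partial_commutator_log_le (hX : X.PosSemidef) (hX1 : X.trace = 1)
    (hb : 2 ≤ Fintype.card b) (h : Matrix (a × b) (a × b) ℂ) :
    ‖(h * (X * (cfc (fun x : ℝ => if x = 0 then 0 else -Real.log x - 1) (partialTrace X) ⊗ₖ
        (1 : Matrix b b ℂ)) -
      (cfc (fun x : ℝ => if x = 0 then 0 else -Real.log x - 1) (partialTrace X) ⊗ₖ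
        (1 : Matrix b b ℂ)) * X)).trace‖
      ≤ ‖h‖ * (4 * Real.exp 1 * Real.log (Fintype.card b)) := by
  have hR := posSemidef_partialTrace hX
  rw [cfc_eq_conj hR.isHermitian, conj_unitaryKronOne hR.isHermitian.eigenvectorUnitary
    (fun i => (((fun x : ℝ => if x = 0 then 0 else -Real.log x - 1)
      (hR.isHermitian.eigenvalues i) : ℝ) : ℂ)), trace_mul_commutator_conj]
  set V := unitaryKronOne (b := b) hR.isHermitian.eigenvectorUnitary
  have hb' : (2 : ℝ) ≤ Fintype.card b := by exact_mod_cast hb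
  refine (norm_trace_commutator_log_le (w := fun i : a × b => hR.isHermitian.eigenvalues i.1)
    (fun i => hR.eigenvalues_nonneg _) (posSemidef_conj_unitary V hX)
    (by rw [trace_conj_unitary, hX1]; simp)
    (by positivity) (dominated_partialTrace hX hR.isHermitian)
    -- One factor of the dimension is the domination constant, the other is the trace of `R ⊗ 1`.
    -- Dimension at least two gives `log K ≥ 2 log 2 > 1`.
    (K := (Fintype.card b : ℝ) ^ 2) ?_ ?_ _).trans ?_
  · rw [Fintype.sum_prod_type]
    simp only [Finset.sum_const, Finset.card_univ, nsmul_eq_mul, ← Finset.mul_sum]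
    rw [sum_eigenvalues_eq_trace_re, trace_partialTrace, hX1]
    simp [sq]
  · rw [Real.log_pow]
    have h1 : Real.log 2 ≤ Real.log (Fintype.card b) := Real.log_le_log (by norm_num) hb'
    have h2 := Real.log_two_gt_d9
    push_cast
    linarith
  · rw [Real.log_pow]
    have hl : 0 ≤ Real.log (Fintype.card b) := Real.log_nonneg (by linarith)
    calc _ ≤ ‖h‖ * (2 * Real.exp 1 * ((2 : ℕ) * Real.log (Fintype.card b))) := by
          gcongr
          exact norm_unitary_conj_le V h
      _ = _ := by push_cast; ring

lemma norm_trace_partial_commutator_rpow_le (hX : X.PosSemidef) {α : ℝ} (hα : 1 / 2 ≤ α)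
    (h : Matrix (a × b) (a × b) ℂ) :
    ‖(h * (X * (cfc (fun x : ℝ => if x = 0 then 0 else α * x ^ (α - 1)) (partialTrace X) ⊗ₖ
        (1 : Matrix b b ℂ)) -
      (cfc (fun x : ℝ => if x = 0 then 0 else α * x ^ (α - 1)) (partialTrace X) ⊗ₖ
        (1 : Matrix b b ℂ)) * X)).trace‖
      ≤ ‖h‖ * (2 * α * (Fintype.card b : ℝ) ^ 2 *
        (cfc (fun x : ℝ => x ^ α) (partialTrace X)).trace.re) := by
  have hR := posSemidef_partialTrace hX
  have hα0 : 0 ≤ α := by linarith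
  have ht := trace_cfc_re hR.isHermitian (fun x : ℝ => x ^ α)
  rw [ht, cfc_eq_conj hR.isHermitian, conj_unitaryKronOne hR.isHermitian.eigenvectorUnitary
    (fun i => (((fun x : ℝ => if x = 0 then 0 else α * x ^ (α - 1))
      (hR.isHermitian.eigenvalues i) : ℝ) : ℂ)), trace_mul_commutator_conj]
  set V := unitaryKronOne (b := b) hR.isHermitian.eigenvectorUnitary
  refine (norm_trace_commutator_rpow_le (w := fun i : a × b => hR.isHermitian.eigenvalues i.1)
    (fun i => hR.eigenvalues_nonneg _) (posSemidef_conj_unitary V hX)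
    (by positivity) hα (dominated_partialTrace hX hR.isHermitian) _).trans ?_
  have hs : ∑ i : a × b, hR.isHermitian.eigenvalues i.1 ^ α
      = (Fintype.card b : ℝ) * ∑ i, hR.isHermitian.eigenvalues i ^ α := by
    rw [Fintype.sum_prod_type]
    simp only [Finset.sum_const, Finset.card_univ, nsmul_eq_mul, ← Finset.mul_sum]
  rw [hs]
  have hn : 0 ≤ ∑ i, hR.isHermitian.eigenvalues i ^ α :=
    Finset.sum_nonneg fun i _ => Real.rpow_nonneg (hR.eigenvalues_nonneg i) _
  calc _ ≤ ‖h‖ * (2 * α * (Fintype.card b : ℝ) *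
        ((Fintype.card b : ℝ) * ∑ i, hR.isHermitian.eigenvalues i ^ α)) := by
        gcongr
        exact norm_unitary_conj_le V h
    _ = _ := by ring

end PartialTrace

/-! ### Differentiating the trace of a function of a moving density matrix -/

section TraceDeriv

open Matrix Complex
open scoped Matrix.Norms.L2Operator ComplexOrder Kronecker

open Filter Topology Asymptotics

/-- A zero is a minimum, so the derivative vanishes there and is `O(t - t₀)` nearby; the mean value
inequality integrates this. -/
lemma eventually_le_sq_of_nonneg {q : ℝ → ℝ} (hq : ContDiff ℝ 2 q) (h0 : ∀ t, 0 ≤ q t) {t₀ : ℝ}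
    (ht : q t₀ = 0) : ∃ C, 0 ≤ C ∧ ∀ᶠ t in 𝓝 t₀, q t ≤ C * (t - t₀) ^ 2 := by
  have hd : Differentiable ℝ q := hq.differentiable (by norm_num)
  have hd2 : Differentiable ℝ (deriv q) :=
    (contDiff_succ_iff_deriv (n := 1).1 hq).2.2.differentiable (by norm_num)
  have hmin : IsLocalMin q t₀ := Eventually.of_forall fun t => by rw [ht]; exact h0 t
  have hz := hmin.deriv_eq_zero
  obtain ⟨C, hC⟩ := (hd2 t₀).isBigO_sub.bound
  refine ⟨|C|, abs_nonneg _, ?_⟩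
  obtain ⟨δ, hδ, hball⟩ := Metric.eventually_nhds_iff_ball.1 hC
  filter_upwards [Metric.ball_mem_nhds t₀ hδ] with t htb
  have hsub : Metric.closedBall t₀ |t - t₀| ⊆ Metric.ball t₀ δ := by
    refine Metric.closedBall_subset_ball ?_
    simpa [Real.dist_eq] using htb
  have key := Convex.norm_image_sub_le_of_norm_deriv_le (f := q) (C := |C| * |t - t₀|)
    (s := Metric.closedBall t₀ |t - t₀|) (x := t₀) (y := t) (fun x _ => hd x) (by
      intro x hx
      have h1 := hball x (hsub hx)
      rw [hz, sub_zero] at h1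
      refine h1.trans ?_
      have h2 : ‖x - t₀‖ ≤ |t - t₀| := by simpa [Real.dist_eq] using hx
      gcongr
      exact le_abs_self C) (convex_closedBall _ _) (by simp) (by simp [Real.dist_eq])
  rw [ht, sub_zero, Real.norm_eq_abs, Real.norm_eq_abs] at key
  calc q t ≤ |q t| := le_abs_self _
    _ ≤ |C| * |t - t₀| * |t - t₀| := key
    _ = |C| * (t - t₀) ^ 2 := by rw [mul_assoc, ← sq, sq_abs]

/-- Functions `f` on `[0, 1]` with `f 0 = 0`, differentiable away from zero with derivative `f'`,
and Hölder at zero with an exponent larger than `1 / 2`. -/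
structure TraceDifferentiable (f f' : ℝ → ℝ) : Prop where
  zero : f 0 = 0
  deriv_zero : f' 0 = 0
  hasDerivAt : ∀ x, 0 < x → HasDerivAt f (f' x) x
  holder : ∃ C β : ℝ, 0 ≤ C ∧ 1 / 2 < β ∧ β ≤ 1 ∧ ∀ x, 0 ≤ x → x ≤ 1 → |f x| ≤ C * x ^ β

lemma TraceDifferentiable.remainder_le {f f' : ℝ → ℝ} (hf : TraceDifferentiable f f') {x : ℝ}
    (hx : 0 < x) {ε : ℝ} (hε : 0 < ε) :
    ∃ K, 0 ≤ K ∧ ∀ y, 0 ≤ y → y ≤ 1 →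
      |f y - f x - f' x * (y - x)| ≤ ε * |y - x| + K * (y - x) ^ 2 := by
  obtain ⟨C, β, hC, hβ, hβ1, hb⟩ := hf.holder
  have ho := (hasDerivAt_iff_isLittleO.1 (hf.hasDerivAt x hx)).bound hε
  obtain ⟨δ, hδ, hball⟩ := Metric.eventually_nhds_iff_ball.1 ho
  set B := C + |f x| + |f' x| * (1 + x) with hB
  have hB0 : 0 ≤ B := by positivity
  -- Near `x` differentiability gives the `ε` term. At distance at least `δ` everything is bounded
  -- by `B`, which the quadratic term absorbs.
  refine ⟨B / δ ^ 2, by positivity, fun y hy0 hy1 => ?_⟩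
  by_cases hy : |y - x| < δ
  · have h1 := hball y (by simpa [Real.dist_eq] using hy)
    simp only [smul_eq_mul, Real.norm_eq_abs] at h1
    rw [mul_comm (f' x)]
    have : 0 ≤ B / δ ^ 2 * (y - x) ^ 2 := by positivity
    linarith
  · have h2 : |f y - f x - f' x * (y - x)| ≤ B := by
      have h3 : |f y| ≤ C := by
        refine (hb y hy0 hy1).trans ?_
        have := Real.rpow_le_one hy0 hy1 (by linarith : 0 ≤ β)
        calc C * y ^ β ≤ C * 1 := by gcongr
          _ = C := mul_one C
      have h4 : |y - x| ≤ 1 + x := by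
        rw [abs_le]; constructor <;> linarith
      calc _ ≤ |f y| + |f x| + |f' x * (y - x)| :=
            (abs_sub _ _).trans (add_le_add (abs_sub _ _) le_rfl)
        _ ≤ B := by rw [abs_mul, hB]; gcongr
    have h5 : δ ^ 2 ≤ (y - x) ^ 2 := by
      rw [← sq_abs (y - x)]
      have := not_lt.1 hy
      gcongr
    have h6 : B ≤ B / δ ^ 2 * (y - x) ^ 2 := by
      rw [div_mul_eq_mul_div, le_div_iff₀ (by positivity)]
      gcongr
    have : 0 ≤ ε * |y - x| := by positivity
    linarith

/-- Here `p` is an overlap weight and `μ` an eigenvalue at time `t`. At `x = 0`, since `p ≤ p^β`,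
the remainder is at most a multiple of `(p μ)^β = O(|t - t₀|^(2β))` with `2β > 1`. At `x > 0`, `p² ≤
p` turns the bound on `p (x - μ)²` into one on `p |μ - x|`. -/
lemma TraceDifferentiable.isLittleO {f f' : ℝ → ℝ} (hf : TraceDifferentiable f f') {x : ℝ}
    (hx : 0 ≤ x) {p μ : ℝ → ℝ} (hp0 : ∀ t, 0 ≤ p t) (hp1 : ∀ t, p t ≤ 1)
    (hμ0 : ∀ t, 0 ≤ μ t) (hμ1 : ∀ t, μ t ≤ 1) {t₀ C : ℝ} (hC : 0 ≤ C)
    (h1 : ∀ᶠ t in 𝓝 t₀, p t * (x - μ t) ^ 2 ≤ C * (t - t₀) ^ 2)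
    (h2 : x = 0 → ∀ᶠ t in 𝓝 t₀, p t * μ t ≤ C * (t - t₀) ^ 2) :
    (fun t => p t * (f (μ t) - f x - f' x * (μ t - x))) =o[𝓝 t₀] fun t => t - t₀ := by
  rcases hx.eq_or_lt with rfl | hx
  · obtain ⟨B, β, hB, hβ, hβ1, hb⟩ := hf.holder
    have hO : (fun t => p t * (f (μ t) - f 0 - f' 0 * (μ t - 0))) =O[𝓝 t₀]
        fun t => |t - t₀| ^ (2 * β) := by
      refine IsBigO.of_bound (B * C ^ β) ?_
      filter_upwards [h2 rfl] with t ht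
      rw [hf.zero, hf.deriv_zero, zero_mul, sub_zero, sub_zero, Real.norm_eq_abs, abs_mul,
        abs_of_nonneg (hp0 t), Real.norm_of_nonneg (by positivity)]
      have hpβ : p t ≤ p t ^ β := by
        rcases (hp0 t).eq_or_lt with h | h
        · rw [← h]; positivity
        · conv_lhs => rw [← Real.rpow_one (p t)]
          exact Real.rpow_le_rpow_of_exponent_ge h (hp1 t) hβ1
      calc p t * |f (μ t)| ≤ p t ^ β * (B * μ t ^ β) := by
            gcongr
            · exact Real.rpow_nonneg (hp0 t) _
            · exact hb _ (hμ0 t) (hμ1 t)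
        _ = B * (p t * μ t) ^ β := by rw [Real.mul_rpow (hp0 t) (hμ0 t)]; ring
        _ ≤ B * (C * (t - t₀) ^ 2) ^ β := by
            gcongr
            exact mul_nonneg (hp0 t) (hμ0 t)
        _ = B * C ^ β * |t - t₀| ^ (2 * β) := by
            rw [Real.mul_rpow hC (sq_nonneg _), ← sq_abs, ← Real.rpow_natCast,
              ← Real.rpow_mul (abs_nonneg _)]
            push_cast
            ring
    refine hO.trans_isLittleO ?_
    have h3 : Tendsto (fun t => |t - t₀| ^ (2 * β - 1)) (𝓝 t₀) (𝓝 0) := by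
      have : ContinuousAt (fun t => |t - t₀| ^ (2 * β - 1)) t₀ :=
        ContinuousAt.rpow_const (by fun_prop) (Or.inr (by linarith))
      have h := this.tendsto
      simp only [sub_self, abs_zero] at h
      rwa [Real.zero_rpow (by linarith)] at h
    refine IsLittleO.of_bound fun c hc => ?_
    filter_upwards [h3.eventually_lt_const hc] with t ht
    rw [Real.norm_of_nonneg (by positivity), Real.norm_eq_abs]
    have h4 : |t - t₀| ^ (2 * β) = |t - t₀| ^ (2 * β - 1) * |t - t₀| := by
      conv_rhs => rw [← Real.rpow_one (|t - t₀|), ← Real.rpow_mul (abs_nonneg _), one_mul]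
      rw [← Real.rpow_add' (abs_nonneg _) (by linarith)]
      ring_nf
    rw [h4]
    gcongr
  · refine IsLittleO.of_bound fun c hc => ?_
    obtain ⟨K, hK, hr⟩ := hf.remainder_le hx (ε := c / (2 * (C + 1))) (by positivity)
    have h3 : ∀ᶠ t in 𝓝 t₀, K * C * |t - t₀| < c / 2 := by
      have : Tendsto (fun t => K * C * |t - t₀|) (𝓝 t₀) (𝓝 (K * C * |t₀ - t₀|)) :=
        Continuous.tendsto (by fun_prop) t₀
      rw [sub_self, abs_zero, mul_zero] at this
      exact this.eventually_lt_const (by positivity)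
    filter_upwards [h1, h3] with t ht ht3
    have h4 : p t * |μ t - x| ≤ (C + 1) * |t - t₀| := by
      refine abs_le_of_sq_le_sq' ?_ (by positivity) |>.2
      have hsq : |μ t - x| ^ 2 = (x - μ t) ^ 2 := by rw [sq_abs]; ring
      have hsq' : |t - t₀| ^ 2 = (t - t₀) ^ 2 := sq_abs _
      rw [mul_pow, mul_pow, hsq, hsq']
      calc p t ^ 2 * (x - μ t) ^ 2 ≤ p t * (x - μ t) ^ 2 := by
            gcongr
            nlinarith [hp0 t, hp1 t]
        _ ≤ C * (t - t₀) ^ 2 := ht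
        _ ≤ (C + 1) ^ 2 * (t - t₀) ^ 2 := by
            gcongr
            nlinarith
    rw [Real.norm_eq_abs, Real.norm_eq_abs, abs_mul, abs_of_nonneg (hp0 t)]
    calc p t * |f (μ t) - f x - f' x * (μ t - x)|
        ≤ p t * (c / (2 * (C + 1)) * |μ t - x| + K * (μ t - x) ^ 2) := by
          gcongr
          · exact hp0 t
          · exact hr _ (hμ0 t) (hμ1 t)
      _ = c / (2 * (C + 1)) * (p t * |μ t - x|) + K * (p t * (x - μ t) ^ 2) := by ring
      _ ≤ c / (2 * (C + 1)) * ((C + 1) * |t - t₀|) + K * (C * (t - t₀) ^ 2) := by gcongr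
      _ = c / 2 * |t - t₀| + K * C * |t - t₀| * |t - t₀| := by
          rw [← sq_abs (t - t₀)]; field_simp
      _ ≤ c / 2 * |t - t₀| + c / 2 * |t - t₀| := by gcongr
      _ = c * |t - t₀| := by ring

variable {n : Type*} [Fintype n] [DecidableEq n]

/-- The functional `M ↦ Re Tr (G M)`. -/
noncomputable def reTraceMul (G : Matrix n n ℂ) : Matrix n n ℂ →L[ℝ] ℝ :=
  LinearMap.toContinuousLinearMap
    { toFun := fun M => (G * M).trace.re
      map_add' := fun M N => by simp [mul_add]
      map_smul' := fun c M => by simp }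

lemma reTraceMul_apply (G M : Matrix n n ℂ) : reTraceMul G M = (G * M).trace.re := rfl

/-- The squared overlaps of the columns of two unitaries. -/
noncomputable def overlap (U V : Matrix.unitaryGroup n ℂ) (j k : n) : ℝ :=
  normSq (((star U : Matrix n n ℂ) * (V : Matrix n n ℂ)) j k)

lemma overlap_nonneg (U V : Matrix.unitaryGroup n ℂ) (j k : n) : 0 ≤ overlap U V j k :=
  normSq_nonneg _

lemma overlap_le_one (U V : Matrix.unitaryGroup n ℂ) (j k : n) : overlap U V j k ≤ 1 := by
  have h := entry_norm_bound_of_unitary (U := ((star U * V : Matrix.unitaryGroup n ℂ) :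
    Matrix n n ℂ)) (star U * V).2 j k
  rw [overlap, normSq_eq_norm_sq]
  exact pow_le_one₀ (norm_nonneg _) h

lemma trace_conj_mul_conj (U V : Matrix.unitaryGroup n ℂ) (x y : n → ℝ) :
    (((U : Matrix n n ℂ) * diagonal (fun i => (x i : ℂ)) * (star U : Matrix n n ℂ)) *
      ((V : Matrix n n ℂ) * diagonal (fun i => (y i : ℂ)) * (star V : Matrix n n ℂ))).trace.re
      = ∑ j, ∑ k, x j * y k * overlap U V j k := by
  set W := (star U : Matrix n n ℂ) * (V : Matrix n n ℂ) with hW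
  have hW' : (star V : Matrix n n ℂ) * (U : Matrix n n ℂ) = Wᴴ := by
    rw [hW, conjTranspose_mul]; simp [star_eq_conjTranspose]
  have h1 : (((U : Matrix n n ℂ) * diagonal (fun i => (x i : ℂ)) * (star U : Matrix n n ℂ)) *
      ((V : Matrix n n ℂ) * diagonal (fun i => (y i : ℂ)) * (star V : Matrix n n ℂ))).trace
      = (diagonal (fun i => (x i : ℂ)) * W * (diagonal (fun i => (y i : ℂ)) * Wᴴ)).trace := by
    rw [← hW', hW]
    simp only [mul_assoc]
    rw [Matrix.trace_mul_comm]
    simp only [mul_assoc]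
  rw [h1, Matrix.trace, Complex.re_sum]
  refine Finset.sum_congr rfl fun j _ => ?_
  rw [Matrix.diag_apply, Matrix.mul_apply, Complex.re_sum]
  refine Finset.sum_congr rfl fun k _ => ?_
  rw [Matrix.diagonal_mul, Matrix.diagonal_mul, conjTranspose_apply, overlap, ← hW,
    show (x j : ℂ) * W j k * (y k * star (W j k)) = x j * y k * (W j k * star (W j k)) by ring,
    Complex.star_def, Complex.mul_conj, ← ofReal_mul, ← ofReal_mul, ofReal_re]

lemma conj_one (U : Matrix.unitaryGroup n ℂ) :
    (U : Matrix n n ℂ) * diagonal (fun _ => ((1 : ℝ) : ℂ)) * (star U : Matrix n n ℂ) = 1 := by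
  rw [ofReal_one, diagonal_one, mul_one]
  exact Unitary.coe_mul_star_self U

lemma conj_mul_conj (U : Matrix.unitaryGroup n ℂ) (A B : Matrix n n ℂ) :
    (U : Matrix n n ℂ) * A * (star U : Matrix n n ℂ) *
      ((U : Matrix n n ℂ) * B * (star U : Matrix n n ℂ)) =
    (U : Matrix n n ℂ) * (A * B) * (star U : Matrix n n ℂ) := by
  have h : (U : Matrix n n ℂ) * A * (star U : Matrix n n ℂ) *
      ((U : Matrix n n ℂ) * B * (star U : Matrix n n ℂ)) =
      (U : Matrix n n ℂ) * (A * (((star U : Matrix n n ℂ) * (U : Matrix n n ℂ)) * B)) *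
      (star U : Matrix n n ℂ) := by simp only [mul_assoc]
  rw [h, Unitary.coe_star_mul_self, one_mul]

lemma norm_trace_mul_self_le (M : Matrix n n ℂ) :
    ‖(M * M).trace‖ ≤ (Fintype.card n : ℝ) ^ 2 * ‖M‖ ^ 2 := by
  simp only [Matrix.trace, Matrix.diag_apply, Matrix.mul_apply]
  calc _ ≤ ∑ _i : n, ∑ _j : n, ‖M‖ ^ 2 := by
        refine (norm_sum_le _ _).trans (Finset.sum_le_sum fun i _ => (norm_sum_le _ _).trans
          (Finset.sum_le_sum fun j _ => ?_))
        rw [norm_mul, sq]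
        gcongr <;> exact norm_entry_le_norm M _ _
    _ = _ := by simp; ring

/-- The rows and columns of the overlap matrix sum to one, so every trace involved becomes a double
sum with the same weights. The remainder is then a weighted sum of scalar Taylor remainders,
estimated pair by pair; the eigenvectors `V t` may depend on `t` arbitrarily. -/
theorem hasDerivAt_trace_cfc {f f' : ℝ → ℝ} (hf : TraceDifferentiable f f')
    {R : ℝ → Matrix n n ℂ} (hR : ContDiff ℝ 2 R) (hpos : ∀ t, (R t).PosSemidef)
    (htr : ∀ t, (R t).trace = 1) {t₀ : ℝ} {R' : Matrix n n ℂ} (hR' : HasDerivAt R R' t₀) :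
    HasDerivAt (fun t => (cfc f (R t)).trace.re) (cfc f' (R t₀) * R').trace.re t₀ := by
  set U := (hpos t₀).isHermitian.eigenvectorUnitary with hU
  set x := (hpos t₀).isHermitian.eigenvalues with hx
  set V := fun t => (hpos t).isHermitian.eigenvectorUnitary with hV
  set μ := fun t => (hpos t).isHermitian.eigenvalues with hμ
  have hx0 : ∀ j, 0 ≤ x j := (hpos t₀).eigenvalues_nonneg
  have hμ0 : ∀ t k, 0 ≤ μ t k := fun t => (hpos t).eigenvalues_nonneg
  have hμ1 : ∀ t k, μ t k ≤ 1 := fun t k => by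
    have h1 := sum_eigenvalues_eq_trace_re (hpos t).isHermitian
    rw [htr t, one_re] at h1
    rw [← h1]
    exact Finset.single_le_sum (fun i _ => hμ0 t i) (Finset.mem_univ k)
  have hRt : ∀ t, R t = (V t : Matrix n n ℂ) * diagonal (fun i => (μ t i : ℂ)) *
      (star (V t) : Matrix n n ℂ) := fun t => eq_conj_eigenvalues _
  have hR0 : R t₀ = (U : Matrix n n ℂ) * diagonal (fun i => (x i : ℂ)) *
      (star U : Matrix n n ℂ) := hRt t₀
  have hcross : ∀ (g : n → ℝ) t, ((U : Matrix n n ℂ) * diagonal (fun i => (g i : ℂ)) *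
      (star U : Matrix n n ℂ) * R t).trace.re = ∑ j, ∑ k, g j * μ t k * overlap U (V t) j k :=
    fun g t => by rw [hRt t, trace_conj_mul_conj]
  have hleft : ∀ (g : n → ℝ) t, ((U : Matrix n n ℂ) * diagonal (fun i => (g i : ℂ)) *
      (star U : Matrix n n ℂ)).trace.re = ∑ j, ∑ k, g j * 1 * overlap U (V t) j k := by
    intro g t
    rw [← trace_conj_mul_conj, conj_one, mul_one]
  have hright : ∀ (g : n → ℝ) t, ((V t : Matrix n n ℂ) * diagonal (fun i => (g i : ℂ)) *
      (star (V t) : Matrix n n ℂ)).trace.re = ∑ j, ∑ k, 1 * g k * overlap U (V t) j k := by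
    intro g t
    rw [← trace_conj_mul_conj, conj_one, one_mul]
  -- the quadratic bounds on the overlaps
  obtain ⟨C₁, hC₁0, hC₁⟩ : ∃ C, 0 ≤ C ∧ ∀ᶠ t in 𝓝 t₀, ∀ j k,
      overlap U (V t) j k * (x j - μ t k) ^ 2 ≤ C * (t - t₀) ^ 2 := by
    obtain ⟨B, hB⟩ := hR'.differentiableAt.isBigO_sub.bound
    refine ⟨(Fintype.card n : ℝ) ^ 2 * B ^ 2, by positivity, ?_⟩
    filter_upwards [hB] with t ht j k
    -- The squared Hilbert–Schmidt distance is the weighted sum of squared eigenvalue differences,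
    -- so each summand is quadratic in `t - t₀`.
    have e : ((R t - R t₀) * (R t - R t₀)).trace.re
        = ∑ j, ∑ k, overlap U (V t) j k * (x j - μ t k) ^ 2 := by
      have e1 : (R t * R t).trace.re = ∑ j, ∑ k, 1 * μ t k ^ 2 * overlap U (V t) j k := by
        rw [← hright]
        conv_lhs => rw [hRt t, conj_mul_conj, diagonal_mul_diagonal]
        simp [sq]
      have e2 : (R t₀ * R t₀).trace.re = ∑ j, ∑ k, x j ^ 2 * 1 * overlap U (V t) j k := by
        rw [← hleft]
        conv_lhs => rw [hR0, conj_mul_conj, diagonal_mul_diagonal]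
        simp [sq]
      have e3 : (R t₀ * R t).trace.re = ∑ j, ∑ k, x j * μ t k * overlap U (V t) j k := by
        rw [← hcross, ← hR0]
      rw [sub_mul, mul_sub, mul_sub, trace_sub, trace_sub, trace_sub, sub_re, sub_re, sub_re,
        Matrix.trace_mul_comm (R t) (R t₀), e1, e2, e3]
      simp only [← Finset.sum_sub_distrib]
      refine Finset.sum_congr rfl fun j _ => Finset.sum_congr rfl fun k _ => ?_
      ring
    have hnn : ∀ j k, 0 ≤ overlap U (V t) j k * (x j - μ t k) ^ 2 := fun j k =>
      mul_nonneg (overlap_nonneg _ _ _ _) (sq_nonneg _)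
    calc _ ≤ ∑ j, ∑ k, overlap U (V t) j k * (x j - μ t k) ^ 2 :=
          (Finset.single_le_sum (f := fun k => overlap U (V t) j k * (x j - μ t k) ^ 2)
            (fun k _ => hnn j k) (Finset.mem_univ k)).trans
          (Finset.single_le_sum (f := fun j => ∑ k, overlap U (V t) j k * (x j - μ t k) ^ 2)
            (fun j _ => Finset.sum_nonneg fun k _ => hnn j k) (Finset.mem_univ j))
      _ = ((R t - R t₀) * (R t - R t₀)).trace.re := e.symm
      _ ≤ ‖((R t - R t₀) * (R t - R t₀)).trace‖ := re_le_norm _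
      _ ≤ (Fintype.card n : ℝ) ^ 2 * ‖R t - R t₀‖ ^ 2 := norm_trace_mul_self_le _
      _ ≤ (Fintype.card n : ℝ) ^ 2 * (B * ‖t - t₀‖) ^ 2 := by gcongr
      _ = _ := by rw [Real.norm_eq_abs, mul_pow, sq_abs]; ring
  obtain ⟨C₂, hC₂0, hC₂⟩ : ∃ C, 0 ≤ C ∧ ∀ j, x j = 0 → ∀ᶠ t in 𝓝 t₀, ∀ k,
      overlap U (V t) j k * μ t k ≤ C * (t - t₀) ^ 2 := by
    have hj : ∀ j, ∃ C, 0 ≤ C ∧ (x j = 0 → ∀ᶠ t in 𝓝 t₀, ∀ k,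
        overlap U (V t) j k * μ t k ≤ C * (t - t₀) ^ 2) := by
      intro j
      by_cases hxj : x j = 0
      swap
      · exact ⟨0, le_rfl, fun h => absurd h hxj⟩
      -- The projection onto an eigenvector in the kernel of `R t₀`: the expectation of `R t` in it
      -- is nonnegative, `C²` and zero at `t₀`.
      set G := (U : Matrix n n ℂ) * diagonal (fun i => ((Pi.single j (1 : ℝ) : n → ℝ) i : ℂ)) *
        (star U : Matrix n n ℂ) with hG
      have hq : ∀ t, reTraceMul G (R t) = ∑ k, μ t k * overlap U (V t) j k := by
        intro t
        rw [reTraceMul_apply, hG, hcross, Finset.sum_eq_single j]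
        · simp
        · intro i _ hi; simp [Pi.single_eq_of_ne hi]
        · simp
      have hnn : ∀ t k, 0 ≤ μ t k * overlap U (V t) j k := fun t k =>
        mul_nonneg (hμ0 t k) (overlap_nonneg _ _ _ _)
      have hq0 : reTraceMul G (R t₀) = 0 := by
        rw [reTraceMul_apply, hG]
        conv_lhs => rw [hR0]
        have : diagonal (fun i => ((Pi.single j (1 : ℝ) : n → ℝ) i : ℂ)) *
            diagonal (fun i => (x i : ℂ)) = 0 := by
          rw [diagonal_mul_diagonal, ← diagonal_zero]
          congr 1
          ext i
          rcases eq_or_ne i j with rfl | hi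
          · simp [hxj]
          · simp [Pi.single_eq_of_ne hi]
        rw [conj_mul_conj, this]
        simp
      obtain ⟨C, hC, hev⟩ := eventually_le_sq_of_nonneg (q := fun t => reTraceMul G (R t))
        ((reTraceMul G).contDiff.comp hR)
        (fun t => by rw [hq]; exact Finset.sum_nonneg fun k _ => hnn t k) hq0
      refine ⟨C, hC, fun _ => ?_⟩
      filter_upwards [hev] with t ht k
      rw [hq] at ht
      rw [mul_comm]
      exact (Finset.single_le_sum (f := fun k => μ t k * overlap U (V t) j k)
        (fun k _ => hnn t k) (Finset.mem_univ k)).trans ht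
    choose C hC hCj using hj
    refine ⟨∑ j, C j, Finset.sum_nonneg fun j _ => hC j, fun j hxj => ?_⟩
    filter_upwards [hCj j hxj] with t ht k
    refine (ht k).trans ?_
    gcongr
    exact Finset.single_le_sum (fun i _ => hC i) (Finset.mem_univ j)
  -- the Taylor remainder
  have hG : cfc f' (R t₀) = (U : Matrix n n ℂ) * diagonal (fun i => ((f' (x i) : ℝ) : ℂ)) *
      (star U : Matrix n n ℂ) := cfc_eq_conj _ _
  have hrem : ∀ t, (cfc f (R t)).trace.re - (cfc f (R t₀)).trace.re
      - reTraceMul (cfc f' (R t₀)) (R t - R t₀)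
      = ∑ j, ∑ k, overlap U (V t) j k * (f (μ t k) - f (x j) - f' (x j) * (μ t k - x j)) := by
    intro t
    have e1 : (cfc f (R t)).trace.re = ∑ j, ∑ k, 1 * f (μ t k) * overlap U (V t) j k := by
      rw [← hright, cfc_eq_conj (hpos t).isHermitian]
    have e2 : (cfc f (R t₀)).trace.re = ∑ j, ∑ k, f (x j) * 1 * overlap U (V t) j k := by
      rw [← hleft, cfc_eq_conj (hpos t₀).isHermitian]
    have e3 : (cfc f' (R t₀) * R t).trace.re
        = ∑ j, ∑ k, f' (x j) * μ t k * overlap U (V t) j k := by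
      rw [hG, hcross]
    have e4 : (cfc f' (R t₀) * R t₀).trace.re
        = ∑ j, ∑ k, f' (x j) * x j * 1 * overlap U (V t) j k := by
      rw [hG, ← hleft]
      conv_lhs => rw [hR0]
      rw [conj_mul_conj, diagonal_mul_diagonal]
      simp
    rw [map_sub, reTraceMul_apply, reTraceMul_apply, e1, e2, e3, e4]
    simp only [← Finset.sum_sub_distrib]
    refine Finset.sum_congr rfl fun j _ => Finset.sum_congr rfl fun k _ => ?_
    ring
  have hlo : (fun t => (cfc f (R t)).trace.re - (cfc f (R t₀)).trace.re
      - reTraceMul (cfc f' (R t₀)) (R t - R t₀)) =o[𝓝 t₀] fun t => t - t₀ := by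
    simp only [hrem]
    refine IsLittleO.fun_sum fun j _ => IsLittleO.fun_sum fun k _ => ?_
    refine hf.isLittleO (C := C₁ + C₂) (hx0 j) (fun t => overlap_nonneg _ _ _ _)
      (fun t => overlap_le_one _ _ _ _) (fun t => hμ0 t k) (fun t => hμ1 t k) (by positivity) ?_ ?_
    · filter_upwards [hC₁] with t ht
      refine (ht j k).trans ?_
      gcongr
      linarith
    · intro hxj
      filter_upwards [hC₂ j hxj] with t ht
      refine (ht k).trans ?_
      gcongr
      linarith
  have hlin : HasDerivAt (fun t => reTraceMul (cfc f' (R t₀)) (R t))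
      (reTraceMul (cfc f' (R t₀)) R') t₀ :=
    ((reTraceMul (cfc f' (R t₀))).hasFDerivAt.comp_hasDerivAt t₀ hR')
  rw [hasDerivAt_iff_isLittleO] at hlin ⊢
  refine (hlo.add hlin).congr_left fun t => ?_
  rw [map_sub, reTraceMul_apply (cfc f' (R t₀)) R']
  ring

end TraceDeriv

/-! ### The entropy functions, and the factorization of locally supported operators -/

section Reduction

open Matrix Complex
open scoped Matrix.Norms.L2Operator ComplexOrder Kronecker

section Scalar

lemma traceDifferentiable_rpow {α : ℝ} (hα : 1 / 2 < α) :
    TraceDifferentiable (fun x => x ^ α) (fun x => if x = 0 then 0 else α * x ^ (α - 1)) where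
  zero := Real.zero_rpow (by linarith)
  deriv_zero := if_pos rfl
  hasDerivAt x hx := by
    simp only [if_neg hx.ne']
    exact Real.hasDerivAt_rpow_const (Or.inl hx.ne')
  holder := by
    refine ⟨1, min α 1, zero_le_one, lt_min hα (by norm_num), min_le_right _ _, fun x h0 h1 => ?_⟩
    rw [one_mul, abs_of_nonneg (Real.rpow_nonneg h0 _)]
    exact Real.rpow_le_rpow_of_exponent_ge' h0 h1 (le_min (by linarith) zero_le_one)
      (min_le_left _ _)

lemma traceDifferentiable_negMulLog :
    TraceDifferentiable (fun x => -(x * Real.log x))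
      (fun x => if x = 0 then 0 else -Real.log x - 1) where
  zero := by simp
  deriv_zero := if_pos rfl
  hasDerivAt x hx := by
    simp only [if_neg hx.ne']
    refine (((hasDerivAt_id x).mul (Real.hasDerivAt_log hx.ne')).neg).congr_deriv ?_
    simp only [id_eq]
    field_simp
    ring
  holder := by
    -- Any exponent strictly between `1/2` and `1` would serve; the constant `4` comes from `|log x|
    -- x^(1/4) < 4` on `(0, 1]`.
    refine ⟨4, 3 / 4, by norm_num, by norm_num, by norm_num, fun x h0 h1 => ?_⟩
    rcases h0.eq_or_lt with rfl | h0
    · simp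
    have h := (Real.abs_log_mul_self_rpow_lt x (1 / 4) h0 h1 (by norm_num)).le
    have hx : x = x ^ (1 / 4 : ℝ) * x ^ (3 / 4 : ℝ) := by
      rw [← Real.rpow_add h0]; norm_num
    have e : |(-(x * Real.log x))| = |Real.log x * x ^ (1 / 4 : ℝ)| * x ^ (3 / 4 : ℝ) := by
      have h2 : x * Real.log x = Real.log x * x ^ (1 / 4 : ℝ) * x ^ (3 / 4 : ℝ) := by
        rw [mul_assoc, ← hx, mul_comm]
      rw [abs_neg, h2, abs_mul, abs_of_nonneg (Real.rpow_nonneg h0.le (3 / 4))]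
    rw [e]
    gcongr
    linarith

end Scalar

section Submatrix

variable {m n : Type*} [Fintype m] [DecidableEq m] [Fintype n] [DecidableEq n]

/-- The submatrix is the compression `Jᴴ M J` by the coordinate inclusion `J`, which satisfies `Jᴴ J
= 1`. -/
lemma norm_submatrix_le (M : Matrix n n ℂ) {f : m → n} (hf : Function.Injective f) :
    ‖M.submatrix f f‖ ≤ ‖M‖ := by
  set J : Matrix n m ℂ := (1 : Matrix n n ℂ).submatrix id f with hJ
  have e : M.submatrix f f = Jᴴ * M * J := by
    ext i j
    simp [hJ, Matrix.mul_apply, Matrix.one_apply]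
  have e1 : Jᴴ * J = 1 := by
    ext i j
    simp [hJ, Matrix.mul_apply, Matrix.one_apply, hf.eq_iff]
  have hJ1 : ‖J‖ ≤ 1 := by
    have h := l2_opNorm_conjTranspose_mul_self J
    rw [e1] at h
    have h1 : ‖(1 : Matrix m m ℂ)‖ ≤ 1 := by
      rw [← diagonal_one, l2_opNorm_diagonal, pi_norm_le_iff_of_nonneg zero_le_one]
      simp
    nlinarith [norm_nonneg J]
  rw [e]
  calc _ ≤ ‖Jᴴ‖ * ‖M‖ * ‖J‖ :=
        (l2_opNorm_mul _ _).trans (by gcongr; exact l2_opNorm_mul _ _)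
    _ ≤ 1 * ‖M‖ * 1 := by
        gcongr
        rwa [l2_opNorm_conjTranspose]
    _ = ‖M‖ := by ring

lemma trace_submatrix_equiv (M : Matrix n n ℂ) (e : m ≃ n) : (M.submatrix e e).trace = M.trace := by
  simp only [Matrix.trace, Matrix.diag_apply, Matrix.submatrix_apply]
  exact Equiv.sum_comp e fun i => M i i

end Submatrix

section Glue

variable {Ξ : Type*} [Fintype Ξ] [DecidableEq Ξ] {d₀ : ℕ}

lemma IsSupportedOn.congr {Λ : Set Ξ} {M : Op Ξ d₀} (hM : IsSupportedOn Λ M)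
    {σ τ σ' τ' : Ξ → Fin d₀} (h1 : ∀ i ∈ Λ, σ i = σ' i) (h2 : ∀ i ∈ Λ, τ i = τ' i)
    (h3 : (∀ i, i ∉ Λ → σ i = τ i) ↔ (∀ i, i ∉ Λ → σ' i = τ' i)) : M σ τ = M σ' τ' := by
  obtain ⟨N, hN⟩ := hM
  rw [hN, hN]
  have e1 : (fun i : Λ => σ i) = fun i : Λ => σ' i := funext fun i => h1 i i.2
  have e2 : (fun i : Λ => τ i) = fun i : Λ => τ' i := funext fun i => h2 i i.2
  rw [e1, e2]
  by_cases h : ∀ i, i ∉ Λ → σ i = τ i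
  · rw [if_pos h, if_pos (h3.1 h)]
  · rw [if_neg h, if_neg fun h' => h (h3.2 h')]

lemma IsSupportedOn.eq_zero {Λ : Set Ξ} {M : Op Ξ d₀} (hM : IsSupportedOn Λ M)
    {σ τ : Ξ → Fin d₀} {i : Ξ} (hi : i ∉ Λ) (h : σ i ≠ τ i) : M σ τ = 0 := by
  obtain ⟨N, hN⟩ := hM
  rw [hN, if_neg fun h' => h (h' i hi)]

/-- Configurations on `A` and on its complement. -/
def glueEquiv (A : Finset Ξ) (d₀ : ℕ) :
    (({i // i ∈ A} → Fin d₀) × ({i // i ∉ A} → Fin d₀)) ≃ (Ξ → Fin d₀) :=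
  (Equiv.piEquivPiSubtypeProd (fun i => i ∈ A) fun _ => Fin d₀).symm

lemma reduced_eq_partialTrace (A : Finset Ξ) (M : Op Ξ d₀) :
    reduced A M = partialTrace (M.submatrix (glueEquiv A d₀) (glueEquiv A d₀)) := rfl

lemma posSemidef_reduced (A : Finset Ξ) {M : Op Ξ d₀} (hM : M.PosSemidef) :
    (reduced A M).PosSemidef := by
  rw [reduced_eq_partialTrace]
  exact posSemidef_partialTrace (hM.submatrix _)

lemma trace_reduced (A : Finset Ξ) (M : Op Ξ d₀) : (reduced A M).trace = M.trace := by
  rw [reduced_eq_partialTrace, trace_partialTrace, trace_submatrix_equiv]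

/-- The reduction as a linear map. -/
def reducedLinear (A : Finset Ξ) (d₀ : ℕ) : Op Ξ d₀ →ₗ[ℂ] Op {i // i ∈ A} d₀ where
  toFun := reduced A
  map_add' M N := by ext; simp [reduced, Finset.sum_add_distrib]
  map_smul' c M := by ext; simp [reduced, Finset.mul_sum]

/-- Configurations on the sites of `Λ` outside `A`. -/
abbrev Inner (A : Finset Ξ) (Λ : Set Ξ) (d₀ : ℕ) : Type _ :=
  {x : {i // i ∉ A} // (x : Ξ) ∈ Λ} → Fin d₀

/-- Configurations on the sites outside `A` and `Λ`. -/
abbrev Outer (A : Finset Ξ) (Λ : Set Ξ) (d₀ : ℕ) : Type _ :=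
  {x : {i // i ∉ A} // (x : Ξ) ∉ Λ} → Fin d₀

variable (A : Finset Ξ) (Λ : Set Ξ) [DecidablePred (· ∈ Λ)]

/-- Configurations on the complement of `A`, split along `Λ`. -/
def splitEquiv (d₀ : ℕ) : (Inner A Λ d₀ × Outer A Λ d₀) ≃ ({i // i ∉ A} → Fin d₀) :=
  (Equiv.piEquivPiSubtypeProd (fun x : {i // i ∉ A} => (x : Ξ) ∈ Λ) fun _ => Fin d₀).symm

/-- Configurations on `A`, on the sites of `Λ` outside `A`, and on the other sites. -/
def tripleEquiv (d₀ : ℕ) :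
    ((({i // i ∈ A} → Fin d₀) × Inner A Λ d₀) × Outer A Λ d₀) ≃ (Ξ → Fin d₀) :=
  ((Equiv.prodAssoc _ _ _).trans
    ((Equiv.refl _).prodCongr (splitEquiv A Λ d₀))).trans (glueEquiv A d₀)

lemma tripleEquiv_of_mem {x : {i // i ∈ A} → Fin d₀} {y : Inner A Λ d₀} {z : Outer A Λ d₀} {i : Ξ}
    (hi : i ∈ A) : tripleEquiv A Λ d₀ ((x, y), z) i = x ⟨i, hi⟩ := by
  simp [tripleEquiv, glueEquiv, hi]

lemma tripleEquiv_of_inner {x : {i // i ∈ A} → Fin d₀} {y : Inner A Λ d₀} {z : Outer A Λ d₀} {i : Ξ}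
    (hi : i ∉ A) (hΛ : i ∈ Λ) : tripleEquiv A Λ d₀ ((x, y), z) i = y ⟨⟨i, hi⟩, hΛ⟩ := by
  simp [tripleEquiv, glueEquiv, splitEquiv, hi, hΛ]

lemma tripleEquiv_of_outer {x : {i // i ∈ A} → Fin d₀} {y : Inner A Λ d₀} {z : Outer A Λ d₀} {i : Ξ}
    (hi : i ∉ A) (hΛ : i ∉ Λ) : tripleEquiv A Λ d₀ ((x, y), z) i = z ⟨⟨i, hi⟩, hΛ⟩ := by
  simp [tripleEquiv, glueEquiv, splitEquiv, hi, hΛ]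

lemma reduced_eq_partialTrace_partialTrace (M : Op Ξ d₀) :
    reduced A M = partialTrace (partialTrace
      (M.submatrix (tripleEquiv A Λ d₀) (tripleEquiv A Λ d₀))) := by
  ext x x'
  simp only [reduced, partialTrace, Matrix.submatrix_apply]
  rw [← Fintype.sum_prod_type', ← Equiv.sum_comp (splitEquiv A Λ d₀)]
  rfl

/-- The operator on `A ∪ Λ` that a given operator supported on `Λ` is made of. -/
def innerOp (M : Op Ξ d₀) (z : Outer A Λ d₀) :
    Matrix (({i // i ∈ A} → Fin d₀) × Inner A Λ d₀) (({i // i ∈ A} → Fin d₀) × Inner A Λ d₀) ℂ :=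
  M.submatrix (fun p => tripleEquiv A Λ d₀ (p, z)) (fun p => tripleEquiv A Λ d₀ (p, z))

lemma norm_innerOp_le (M : Op Ξ d₀) (z : Outer A Λ d₀) : ‖innerOp A Λ M z‖ ≤ ‖M‖ :=
  norm_submatrix_le M fun p q h => by simpa using (tripleEquiv A Λ d₀).injective h

variable {A Λ}

/-- The operator acts trivially on the outer sites, so freezing them at any `z₀` recovers the same
inner factor. -/
lemma IsSupportedOn.submatrix_tripleEquiv {M : Op Ξ d₀} (hM : IsSupportedOn Λ M)
    (z₀ : Outer A Λ d₀) :
    M.submatrix (tripleEquiv A Λ d₀) (tripleEquiv A Λ d₀) =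
      innerOp A Λ M z₀ ⊗ₖ (1 : Matrix (Outer A Λ d₀) (Outer A Λ d₀) ℂ) := by
  ext ⟨⟨x, y⟩, z⟩ ⟨⟨x', y'⟩, z'⟩
  simp only [Matrix.submatrix_apply, kroneckerMap_apply, innerOp]
  by_cases hz : z = z'
  · subst hz
    rw [Matrix.one_apply_eq, mul_one]
    have key : ∀ (x : {i // i ∈ A} → Fin d₀) (y : Inner A Λ d₀), ∀ i ∈ Λ,
        tripleEquiv A Λ d₀ ((x, y), z) i = tripleEquiv A Λ d₀ ((x, y), z₀) i := by
      intro x y i hi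
      by_cases hA : i ∈ A
      · rw [tripleEquiv_of_mem A Λ hA, tripleEquiv_of_mem A Λ hA]
      · rw [tripleEquiv_of_inner A Λ hA hi, tripleEquiv_of_inner A Λ hA hi]
    refine hM.congr (key x y) (key x' y') (forall_congr' fun i => forall_congr' fun hi => ?_)
    by_cases hA : i ∈ A
    · simp only [tripleEquiv_of_mem A Λ hA]
    · simp only [tripleEquiv_of_outer A Λ hA hi]
  · rw [Matrix.one_apply_ne hz, mul_zero]
    obtain ⟨⟨⟨i, hi⟩, hiΛ⟩, hne⟩ := Function.ne_iff.1 hz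
    refine hM.eq_zero (i := i) hiΛ ?_
    rw [tripleEquiv_of_outer A Λ hi hiΛ, tripleEquiv_of_outer A Λ hi hiΛ]
    exact hne

lemma IsSupportedOn.innerOp_of_disjoint {M : Op Ξ d₀} (hM : IsSupportedOn Λ M)
    (hΛ : ∀ i ∈ Λ, i ∉ A) (z₀ : Outer A Λ d₀) (x₀ : {i // i ∈ A} → Fin d₀) :
    innerOp A Λ M z₀ = (1 : Matrix ({i // i ∈ A} → Fin d₀) ({i // i ∈ A} → Fin d₀) ℂ) ⊗ₖ
      (innerOp A Λ M z₀).submatrix (fun y => (x₀, y)) (fun y => (x₀, y)) := by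
  ext ⟨x, y⟩ ⟨x', y'⟩
  simp only [Matrix.submatrix_apply, kroneckerMap_apply, innerOp]
  by_cases hx : x = x'
  · subst hx
    rw [Matrix.one_apply_eq, one_mul]
    refine hM.congr ?_ ?_ (forall_congr' fun i => forall_congr' fun hi => ?_)
    · intro i hi
      rw [tripleEquiv_of_inner A Λ (hΛ i hi) hi, tripleEquiv_of_inner A Λ (hΛ i hi) hi]
    · intro i hi
      rw [tripleEquiv_of_inner A Λ (hΛ i hi) hi, tripleEquiv_of_inner A Λ (hΛ i hi) hi]
    · by_cases hA : i ∈ A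
      · simp only [tripleEquiv_of_mem A Λ hA]
      · simp only [tripleEquiv_of_outer A Λ hA hi]
  · rw [Matrix.one_apply_ne hx, zero_mul]
    obtain ⟨⟨i, hi⟩, hne⟩ := Function.ne_iff.1 hx
    refine hM.eq_zero (i := i) (fun h => hΛ i h hi) ?_
    rw [tripleEquiv_of_mem A Λ hi, tripleEquiv_of_mem A Λ hi]
    exact hne

lemma IsSupportedOn.trace_mul_reduced_commutator {M : Op Ξ d₀} (hM : IsSupportedOn Λ M)
    (z₀ : Outer A Λ d₀) (G : Op {i // i ∈ A} d₀) (ρ : Op Ξ d₀) :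
    (G * reduced A (M * ρ - ρ * M)).trace =
    (innerOp A Λ M z₀ * (partialTrace (ρ.submatrix (tripleEquiv A Λ d₀) (tripleEquiv A Λ d₀)) *
        (G ⊗ₖ (1 : Matrix (Inner A Λ d₀) (Inner A Λ d₀) ℂ)) -
      (G ⊗ₖ (1 : Matrix (Inner A Λ d₀) (Inner A Λ d₀) ℂ)) *
        partialTrace (ρ.submatrix (tripleEquiv A Λ d₀) (tripleEquiv A Λ d₀)))).trace := by
  rw [reduced_eq_partialTrace_partialTrace A Λ, Matrix.submatrix_sub, Pi.sub_apply, Pi.sub_apply,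
    ← Matrix.submatrix_mul_equiv M ρ _ (tripleEquiv A Λ d₀) _,
    ← Matrix.submatrix_mul_equiv ρ M _ (tripleEquiv A Λ d₀) _, hM.submatrix_tripleEquiv z₀]
  exact trace_mul_partialTrace_commutator _ _ _

lemma commute_cfc {a : Type*} [Fintype a] [DecidableEq a] {R : Matrix a a ℂ} (hR : R.IsHermitian)
    (g : ℝ → ℝ) : R * cfc g R = cfc g R * R := by
  rw [cfc_eq_conj hR]
  conv_lhs => enter [1]; rw [eq_conj_eigenvalues hR]
  conv_rhs => enter [2]; rw [eq_conj_eigenvalues hR]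
  rw [conj_mul_conj, conj_mul_conj, diagonal_mul_diagonal, diagonal_mul_diagonal]
  simp only [mul_comm]

/-- There are no inner sites, so the inner factor has dimension one and `X` is the reduced state
itself, which commutes with its functions. -/
lemma trace_mul_reduced_commutator_of_subset {M : Op Ξ d₀} (hM : IsSupportedOn Λ M)
    (z₀ : Outer A Λ d₀) (hΛ : ∀ i ∈ Λ, i ∈ A) {ρ : Op Ξ d₀} (g : ℝ → ℝ)
    (hR : (reduced A ρ).IsHermitian) :
    (cfc g (reduced A ρ) * reduced A (M * ρ - ρ * M)).trace = 0 := by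
  rw [hM.trace_mul_reduced_commutator z₀]
  set X := partialTrace (ρ.submatrix (tripleEquiv A Λ d₀) (tripleEquiv A Λ d₀)) with hX
  have hXR : X = reduced A ρ ⊗ₖ (1 : Matrix (Inner A Λ d₀) (Inner A Λ d₀) ℂ) := by
    have : IsEmpty {x : {i // i ∉ A} // (x : Ξ) ∈ Λ} := ⟨fun x => x.1.2 (hΛ _ x.2)⟩
    rw [reduced_eq_partialTrace_partialTrace A Λ, ← hX]
    ext ⟨x, y⟩ ⟨x', y'⟩
    obtain rfl : y = y' := Subsingleton.elim _ _
    rw [kroneckerMap_apply, Matrix.one_apply_eq, mul_one]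
    conv_rhs => rw [partialTrace]
    rw [Fintype.sum_subsingleton _ y]
  rw [hXR, ← mul_kronecker_mul, ← mul_kronecker_mul, commute_cfc hR]
  simp

lemma trace_mul_reduced_commutator_of_disjoint {M : Op Ξ d₀} (hM : IsSupportedOn Λ M)
    (z₀ : Outer A Λ d₀) (x₀ : {i // i ∈ A} → Fin d₀) (hΛ : ∀ i ∈ Λ, i ∉ A) (ρ : Op Ξ d₀)
    (G : Op {i // i ∈ A} d₀) :
    (G * reduced A (M * ρ - ρ * M)).trace = 0 := by
  rw [hM.trace_mul_reduced_commutator z₀, hM.innerOp_of_disjoint hΛ z₀ x₀, mul_sub, trace_sub,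
    ← mul_assoc, Matrix.trace_mul_comm, ← mul_assoc, ← mul_assoc, ← mul_kronecker_mul,
    ← mul_kronecker_mul]
  simp

end Glue

end Reduction

/-! ### Time evolution and the sum over the terms of the Hamiltonian -/

section Evolution

open Matrix Complex
open scoped Matrix.Norms.L2Operator ComplexOrder Kronecker

variable {Ξ : Type*} [Fintype Ξ] [DecidableEq Ξ] {d₀ : ℕ}

section Evolve

lemma exp_smul_eq (H : Op Ξ d₀) (c : ℂ) (t : ℝ) :
    NormedSpace.exp ((c * t) • H) = NormedSpace.exp (t • (c • H)) := by
  congr 1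
  rw [mul_comm, mul_smul]
  rfl

lemma evolve_eq (H ρ : Op Ξ d₀) (t : ℝ) :
    evolve H ρ t = NormedSpace.exp (t • ((-I) • H)) * ρ * NormedSpace.exp (t • (I • H)) := by
  rw [evolve, ← exp_smul_eq, ← exp_smul_eq, neg_mul]

lemma evolve_eq_conj {H : Op Ξ d₀} (hH : H.IsHermitian) (ρ : Op Ξ d₀) (t : ℝ) :
    evolve H ρ t = NormedSpace.exp ((-(I * t)) • H) * ρ * (NormedSpace.exp ((-(I * t)) • H))ᴴ := by
  rw [evolve, ← Matrix.exp_conjTranspose, conjTranspose_smul, hH.eq]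
  congr 3
  simp

lemma isDensity_evolve {H ρ : Op Ξ d₀} (hH : H.IsHermitian) (hρ : IsDensity ρ) (t : ℝ) :
    IsDensity (evolve H ρ t) := by
  constructor
  · rw [evolve_eq_conj hH]
    exact hρ.1.mul_mul_conjTranspose_same _
  · rw [evolve, Matrix.trace_mul_comm, ← mul_assoc,
      ← Matrix.exp_add_of_commute _ _ ((Commute.refl H).smul_left _ |>.smul_right _), ← add_smul,
      add_neg_cancel, zero_smul, NormedSpace.exp_zero, one_mul, hρ.2]

lemma hasDerivAt_evolve (H ρ : Op Ξ d₀) (t : ℝ) :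
    HasDerivAt (evolve H ρ) ((-I) • (H * evolve H ρ t - evolve H ρ t * H)) t := by
  have h1 := hasDerivAt_exp_smul_const' (𝕂 := ℝ) ((-I) • H) t
  have h2 := hasDerivAt_exp_smul_const (𝕂 := ℝ) (I • H) t
  have h3 := (h1.mul_const ρ).mul h2
  have e : evolve H ρ = fun t => NormedSpace.exp (t • ((-I) • H)) * ρ *
      NormedSpace.exp (t • (I • H)) := funext fun t => evolve_eq H ρ t
  rw [e]
  refine h3.congr_deriv ?_
  simp only [smul_sub, Matrix.mul_smul, Matrix.smul_mul, neg_mul, mul_assoc, neg_smul,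
    sub_neg_eq_add]

lemma contDiff_evolve (H ρ : Op Ξ d₀) : ContDiff ℝ 2 (evolve H ρ) := by
  have hexp : ∀ M : Op Ξ d₀, ContDiff ℝ 2 fun t : ℝ => NormedSpace.exp (t • M) := by
    intro M
    have h : ContDiff ℝ 2 (NormedSpace.exp : Op Ξ d₀ → Op Ξ d₀) :=
      contDiff_iff_contDiffAt.2 fun x => (NormedSpace.exp_analytic (𝕂 := ℝ) x).contDiffAt
    exact h.comp (contDiff_id.smul contDiff_const)
  have e : evolve H ρ = fun t => NormedSpace.exp (t • ((-I) • H)) * ρ *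
      NormedSpace.exp (t • (I • H)) := funext fun t => evolve_eq H ρ t
  rw [e]
  exact ((hexp _).mul contDiff_const).mul (hexp _)

/-- The reduction as a continuous real-linear map. -/
noncomputable def reducedCLM (A : Finset Ξ) (d₀ : ℕ) : Op Ξ d₀ →L[ℝ] Op {i // i ∈ A} d₀ :=
  LinearMap.toContinuousLinearMap ((reducedLinear A d₀).restrictScalars ℝ)

lemma reducedCLM_apply (A : Finset Ξ) (M : Op Ξ d₀) : reducedCLM A d₀ M = reduced A M := rfl

lemma hasDerivAt_trace_cfc_reduced_evolve {f f' : ℝ → ℝ} (hf : TraceDifferentiable f f')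
    {H ρ : Op Ξ d₀} (hH : H.IsHermitian) (hρ : IsDensity ρ) (A : Finset Ξ) (t : ℝ) :
    HasDerivAt (fun s => (cfc f (reduced A (evolve H ρ s))).trace.re)
      (cfc f' (reduced A (evolve H ρ t)) *
        reduced A ((-I) • (H * evolve H ρ t - evolve H ρ t * H))).trace.re t :=
  hasDerivAt_trace_cfc hf ((reducedCLM A d₀).contDiff.comp (contDiff_evolve H ρ))
    (fun s => posSemidef_reduced A (isDensity_evolve hH hρ s).1)
    (fun s => by rw [Function.comp_apply, reducedCLM_apply, trace_reduced,
      (isDensity_evolve hH hρ s).2])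
    ((reducedCLM A d₀).hasFDerivAt.comp_hasDerivAt t (hasDerivAt_evolve H ρ t))

end Evolve

variable {k : ℕ}

/-- The commutator is linear in `H`, so the terms are estimated one at a time and need not be
self-adjoint individually. Only nonzero straddling terms survive. -/
lemma abs_trace_mul_reduced_hamiltonian_le {h : (Fin k → Ξ) → Op Ξ d₀} {A : Finset Ξ}
    {ρ : Op Ξ d₀} {G : Op {i // i ∈ A} d₀} {hbar B : ℝ} (hB : 0 ≤ B)
    (hbd : ∀ i, opNorm (h i) ≤ hbar)
    (hzero : ∀ i, ¬ ((∃ a, i a ∈ A) ∧ (∃ b, i b ∉ A)) →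
      (G * reduced A (h i * ρ - ρ * h i)).trace = 0)
    (hterm : ∀ i, (∃ a, i a ∈ A) → (∃ b, i b ∉ A) →
      ‖(G * reduced A (h i * ρ - ρ * h i)).trace‖ ≤ opNorm (h i) * B) :
    |(G * reduced A ((-I) • (hamiltonian h * ρ - ρ * hamiltonian h))).trace.re|
      ≤ (numStraddling h A : ℝ) * hbar * B := by
  classical
  have e : (G * reduced A ((-I) • (hamiltonian h * ρ - ρ * hamiltonian h))).trace
      = (-I) * ∑ i, (G * reduced A (h i * ρ - ρ * h i)).trace := by
    have h1 : hamiltonian h * ρ - ρ * hamiltonian h = ∑ i, (h i * ρ - ρ * h i) := by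
      rw [hamiltonian, Finset.sum_mul, Finset.mul_sum, Finset.sum_sub_distrib]
    change (G * reducedLinear A d₀ _).trace = _
    rw [h1, map_smul, map_sum, Matrix.mul_smul, trace_smul, Finset.mul_sum, trace_sum, smul_eq_mul]
    rfl
  set S : Finset (Fin k → Ξ) :=
    {i | h i ≠ 0 ∧ (∃ a, i a ∈ A) ∧ (∃ b, i b ∉ A)} with hS
  have hcard : numStraddling h A = S.card := by
    rw [numStraddling, ← Set.ncard_coe_finset]
    congr 1
    ext i
    simp [hS]
  have hsum : ∑ i, (G * reduced A (h i * ρ - ρ * h i)).trace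
      = ∑ i ∈ S, (G * reduced A (h i * ρ - ρ * h i)).trace := by
    refine (Finset.sum_subset (Finset.subset_univ S) fun i _ hi => ?_).symm
    by_cases h0 : h i = 0
    · have : reduced A (h i * ρ - ρ * h i) = 0 := by
        rw [h0]; ext; simp [reduced]
      rw [this]; simp
    · exact hzero i fun hc => hi (by simp [hS, h0, hc])
  refine (Complex.abs_re_le_norm _).trans ?_
  rw [e, norm_mul, norm_neg, norm_I, one_mul, hsum, hcard]
  calc _ ≤ ∑ i ∈ S, hbar * B := by
        refine (norm_sum_le _ _).trans (Finset.sum_le_sum fun i hi => ?_)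
        simp only [hS, Finset.mem_filter, Finset.mem_univ, true_and] at hi
        refine (hterm i hi.2.1 hi.2.2).trans ?_
        gcongr
        exact hbd i
    _ = _ := by simp [mul_assoc]

lemma trace_mul_reduced_commutator_eq_zero {ρ : Op Ξ d₀} (hρ : IsDensity ρ) (A : Finset Ξ)
    (g : ℝ → ℝ) {i : Fin k → Ξ} {M : Op Ξ d₀} (hM : IsSupportedOn (Set.range i) M)
    (hi : ¬ ((∃ a, i a ∈ A) ∧ (∃ b, i b ∉ A))) :
    (cfc g (reduced A ρ) * reduced A (M * ρ - ρ * M)).trace = 0 := by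
  classical
  -- Unit trace rules out an empty configuration space; a configuration is needed to freeze the
  -- outer sites.
  have hne : Nonempty (Ξ → Fin d₀) := by
    by_contra hc
    rw [not_nonempty_iff] at hc
    have := hρ.2
    simp [Matrix.trace] at this
  obtain ⟨σ⟩ := hne
  by_cases h1 : ∃ a, i a ∈ A
  · have h2 : ∀ b, i b ∈ A := by
      by_contra hc
      push Not at hc
      exact hi ⟨h1, hc⟩
    exact trace_mul_reduced_commutator_of_subset hM (fun x => σ x)
      (by rintro _ ⟨b, rfl⟩; exact h2 b) g (posSemidef_reduced A hρ.1).isHermitian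
  · push Not at h1
    exact trace_mul_reduced_commutator_of_disjoint hM (fun x => σ x) (fun x => σ x)
      (by rintro _ ⟨b, rfl⟩; exact h1 b) ρ _

/-- Choose an index for each site of the support outside `A`: the choice is injective and misses the
index whose site lies in `A`. That index also makes `k ≥ 1`, so the subtraction is not truncated. -/
lemma card_inner_le {A : Finset Ξ} {i : Fin k → Ξ}
    [DecidablePred (· ∈ Set.range i)] (h1 : ∃ a, i a ∈ A) :
    Fintype.card {x : {j // j ∉ A} // (x : Ξ) ∈ Set.range i} ≤ k - 1 := by
  obtain ⟨a, ha⟩ := h1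
  have hc : Fintype.card {b : Fin k // b ≠ a} = k - 1 := by
    simp [Fintype.card_subtype_compl]
  rw [← hc]
  have hx : ∀ x : {x : {j // j ∉ A} // (x : Ξ) ∈ Set.range i}, ∃ b : {b : Fin k // b ≠ a},
      i b = x.1.1 := by
    rintro ⟨⟨j, hj⟩, ⟨b, hb⟩⟩
    have hb' : i b = j := hb
    exact ⟨⟨b, fun h => hj (hb' ▸ h ▸ ha)⟩, hb⟩
  choose f hf using hx
  exact Fintype.card_le_of_injective f fun x y hxy =>
    Subtype.ext (Subtype.ext (by rw [← hf, ← hf, hxy]))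

lemma norm_trace_mul_reduced_commutator_log_le {ρ : Op Ξ d₀} (hρ : IsDensity ρ) (A : Finset Ξ)
    {i : Fin k → Ξ} {M : Op Ξ d₀} (hM : IsSupportedOn (Set.range i) M)
    (h1 : ∃ a, i a ∈ A) (h2 : ∃ b, i b ∉ A) :
    ‖(cfc (fun x : ℝ => if x = 0 then 0 else -Real.log x - 1) (reduced A ρ) *
      reduced A (M * ρ - ρ * M)).trace‖
      ≤ opNorm M * (4 * Real.exp 1 * ((k - 1 : ℕ) : ℝ) * Real.log d₀) := by
  classical
  have hMn : (0 : ℝ) ≤ opNorm M := norm_nonneg _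
  -- The logarithmic estimate needs an inner dimension of at least two. For `d₀ < 2` there is at
  -- most one configuration and all operators commute.
  rcases Nat.lt_or_ge d₀ 2 with hd | hd
  · have hsub : Subsingleton (Fin d₀) := by
      interval_cases d₀ <;> infer_instance
    have h0 : M * ρ - ρ * M = 0 := by
      ext σ τ
      obtain rfl : σ = τ := Subsingleton.elim _ _
      simp only [Matrix.sub_apply, Matrix.mul_apply]
      rw [Fintype.sum_subsingleton _ σ, Fintype.sum_subsingleton _ σ, mul_comm, sub_self]
      rfl
    have h3 : reduced A (0 : Op Ξ d₀) = 0 := by ext; simp [reduced]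
    rw [h0, h3, mul_zero, trace_zero, norm_zero]
    have : 0 ≤ Real.log d₀ := Real.log_natCast_nonneg d₀
    positivity
  have hd0 : 0 < d₀ := by omega
  obtain ⟨b, hb⟩ := h2
  set m := Fintype.card {x : {j // j ∉ A} // (x : Ξ) ∈ Set.range i} with hm
  -- Straddling provides an inner site, so the inner dimension is at least `d₀ ≥ 2`.
  have hm1 : 1 ≤ m := Fintype.card_pos_iff.2 ⟨⟨⟨i b, hb⟩, ⟨b, rfl⟩⟩⟩
  have hmk : m ≤ k - 1 := card_inner_le h1
  have hcard : Fintype.card (Inner A (Set.range i) d₀) = d₀ ^ m := by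
    rw [Fintype.card_fun, Fintype.card_fin]
  set z₀ : Outer A (Set.range i) d₀ := fun _ => ⟨0, hd0⟩
  rw [hM.trace_mul_reduced_commutator z₀, reduced_eq_partialTrace_partialTrace A (Set.range i) ρ]
  refine (norm_trace_partial_commutator_log_le (posSemidef_partialTrace (hρ.1.submatrix _))
    (by rw [trace_partialTrace, trace_submatrix_equiv, hρ.2]) ?_ _).trans ?_
  · rw [hcard]
    exact hd.trans (Nat.le_self_pow (by omega) _)
  · rw [hcard]
    push_cast
    rw [Real.log_pow]
    have hl : 0 ≤ Real.log d₀ := Real.log_natCast_nonneg d₀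
    have hin : ‖innerOp A (Set.range i) M z₀‖ ≤ opNorm M := norm_innerOp_le A _ M z₀
    calc _ ≤ opNorm M * (4 * Real.exp 1 * (((k - 1 : ℕ) : ℝ) * Real.log d₀)) := by
          gcongr
      _ = _ := by ring

lemma norm_trace_mul_reduced_commutator_rpow_le {ρ : Op Ξ d₀} (hρ : IsDensity ρ) (A : Finset Ξ)
    {α : ℝ} (hα : 1 / 2 ≤ α)
    {i : Fin k → Ξ} {M : Op Ξ d₀} (hM : IsSupportedOn (Set.range i) M)
    (h1 : ∃ a, i a ∈ A) :
    ‖(cfc (fun x : ℝ => if x = 0 then 0 else α * x ^ (α - 1)) (reduced A ρ) *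
      reduced A (M * ρ - ρ * M)).trace‖
      ≤ opNorm M * (2 * α * (d₀ : ℝ) ^ (2 * (k - 1)) *
        (cfc (fun x : ℝ => x ^ α) (reduced A ρ)).trace.re) := by
  classical
  have hd0 : 0 < d₀ := by
    by_contra hc
    obtain rfl : d₀ = 0 := by omega
    obtain ⟨a, _⟩ := h1
    have : IsEmpty (Ξ → Fin 0) := ⟨fun σ => (σ (i a)).elim0⟩
    have := hρ.2
    simp [Matrix.trace] at this
  have hmk := card_inner_le h1
  set m := Fintype.card {x : {j // j ∉ A} // (x : Ξ) ∈ Set.range i} with hm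
  have hcard : Fintype.card (Inner A (Set.range i) d₀) = d₀ ^ m := by
    rw [Fintype.card_fun, Fintype.card_fin]
  set z₀ : Outer A (Set.range i) d₀ := fun _ => ⟨0, hd0⟩
  have hR := posSemidef_reduced A hρ.1
  have ht : 0 ≤ (cfc (fun x : ℝ => x ^ α) (reduced A ρ)).trace.re := by
    rw [trace_cfc_re hR.isHermitian]
    exact Finset.sum_nonneg fun j _ => Real.rpow_nonneg (hR.eigenvalues_nonneg j) _
  rw [hM.trace_mul_reduced_commutator z₀]
  rw [reduced_eq_partialTrace_partialTrace A (Set.range i) ρ] at ht ⊢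
  refine (norm_trace_partial_commutator_rpow_le (posSemidef_partialTrace (hρ.1.submatrix _))
    hα _).trans ?_
  rw [hcard]
  have hin : ‖innerOp A (Set.range i) M z₀‖ ≤ opNorm M := norm_innerOp_le A _ M z₀
  have hp : ((d₀ ^ m : ℕ) : ℝ) ^ 2 ≤ (d₀ : ℝ) ^ (2 * (k - 1)) := by
    push_cast
    rw [← pow_mul]
    exact pow_le_pow_right₀ (by exact_mod_cast hd0) (by omega)
  have hMn : (0 : ℝ) ≤ opNorm M := norm_nonneg _
  have hα0 : 0 ≤ α := by linarith
  gcongr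

lemma trace_cfc_rpow_pos {ρ : Op Ξ d₀} (hρ : IsDensity ρ) (A : Finset Ξ) (α : ℝ) :
    0 < (cfc (fun x : ℝ => x ^ α) (reduced A ρ)).trace.re := by
  have hR := posSemidef_reduced A hρ.1
  have h1 := sum_eigenvalues_eq_trace_re hR.isHermitian
  rw [trace_reduced, hρ.2, one_re] at h1
  rw [trace_cfc_re hR.isHermitian]
  obtain ⟨j, hj, hpos⟩ : ∃ j ∈ Finset.univ, 0 < hR.isHermitian.eigenvalues j :=
    Finset.exists_lt_of_sum_lt (by rw [h1]; simp)
  exact Finset.sum_pos' (fun j _ => Real.rpow_nonneg (hR.eigenvalues_nonneg j) _)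
    ⟨j, hj, Real.rpow_pos_of_pos hpos _⟩

end Evolution

end QuditEntropy

/-! ### The entropy rate bound -/

theorem mainTheorem3 :
    ∃ (c : ℝ) (c' : ℝ → ℝ),
      ∀ (Ξ : Type*) [Fintype Ξ] [DecidableEq Ξ] (d₀ k : ℕ)
        (h : (Fin k → Ξ) → QuditEntropy.Op Ξ d₀) (hbar : ℝ) (A : Finset Ξ)
        (ρ : QuditEntropy.Op Ξ d₀) (α t : ℝ),
        QuditEntropy.IsKLocal h →
        (∀ i : Fin k → Ξ, QuditEntropy.opNorm (h i) ≤ hbar) →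
        QuditEntropy.IsDensity ρ →
        1 / 2 < α →
        DifferentiableAt ℝ
            (fun s : ℝ => QuditEntropy.entropyAt (QuditEntropy.hamiltonian h) ρ A α s) t ∧
          |deriv (fun s : ℝ => QuditEntropy.entropyAt (QuditEntropy.hamiltonian h) ρ A α s) t| ≤
            (QuditEntropy.numStraddling h A : ℝ) * hbar *
              (if α = 1 then c * ((k - 1 : ℕ) : ℝ) * Real.log (d₀ : ℝ)
                else c' α * (d₀ : ℝ) ^ (2 * (k - 1))) := by
  -- The factor `4e` is Cauchy's `2e` times the `2` from `log D²`. In the second constant, `2α`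
  -- comes from the two values of `F` and `1 / |1 - α|` from the prefactor of the entropy.
  refine ⟨4 * Real.exp 1, fun α => 2 * α / |1 - α|, ?_⟩
  intro Ξ _ _ d₀ k h hbar A ρ α t hloc hbd hρ hα
  have hρt := QuditEntropy.isDensity_evolve hloc.isHermitian hρ t
  by_cases h1 : α = 1
  · have hd := QuditEntropy.hasDerivAt_trace_cfc_reduced_evolve
      QuditEntropy.traceDifferentiable_negMulLog hloc.isHermitian hρ A t
    have e : (fun s : ℝ => QuditEntropy.entropyAt (QuditEntropy.hamiltonian h) ρ A α s) =
        fun s => (cfc (fun x : ℝ => -(x * Real.log x))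
          (QuditEntropy.reduced A (QuditEntropy.evolve (QuditEntropy.hamiltonian h) ρ s))).trace.re :=
      funext fun s => by rw [QuditEntropy.entropyAt, QuditEntropy.renyiEntropy, if_pos h1]
    rw [e]
    refine ⟨hd.differentiableAt, ?_⟩
    rw [hd.deriv, if_pos h1]
    have hl : 0 ≤ Real.log d₀ := Real.log_natCast_nonneg d₀
    exact QuditEntropy.abs_trace_mul_reduced_hamiltonian_le (by positivity) hbd
      (fun i hi => QuditEntropy.trace_mul_reduced_commutator_eq_zero hρt A _ (hloc.supported i) hi)
      (fun i hi hi' => QuditEntropy.norm_trace_mul_reduced_commutator_log_le hρt A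
        (hloc.supported i) hi hi')
  · have hd := QuditEntropy.hasDerivAt_trace_cfc_reduced_evolve
      (QuditEntropy.traceDifferentiable_rpow hα) hloc.isHermitian hρ A t
    have hpos := QuditEntropy.trace_cfc_rpow_pos hρt A α
    have hd2 := (hd.log hpos.ne').const_mul (1 - α)⁻¹
    have e : (fun s : ℝ => QuditEntropy.entropyAt (QuditEntropy.hamiltonian h) ρ A α s) =
        fun s => (1 - α)⁻¹ * Real.log (cfc (fun x : ℝ => x ^ α)
          (QuditEntropy.reduced A (QuditEntropy.evolve (QuditEntropy.hamiltonian h) ρ s))).trace.re :=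
      funext fun s => by rw [QuditEntropy.entropyAt, QuditEntropy.renyiEntropy, if_neg h1]
    rw [e]
    refine ⟨hd2.differentiableAt, ?_⟩
    rw [hd2.deriv, if_neg h1]
    have hα0 : 0 ≤ α := by linarith
    -- The bound is proportional to `Tr R^α`, which cancels the denominator from differentiating the
    -- logarithm.
    have key := QuditEntropy.abs_trace_mul_reduced_hamiltonian_le (h := h) (A := A)
      (ρ := QuditEntropy.evolve (QuditEntropy.hamiltonian h) ρ t)
      (G := cfc (fun x : ℝ => if x = 0 then 0 else α * x ^ (α - 1))
        (QuditEntropy.reduced A (QuditEntropy.evolve (QuditEntropy.hamiltonian h) ρ t)))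
      (B := 2 * α * (d₀ : ℝ) ^ (2 * (k - 1)) * (cfc (fun x : ℝ => x ^ α)
        (QuditEntropy.reduced A (QuditEntropy.evolve (QuditEntropy.hamiltonian h) ρ t))).trace.re)
      (by positivity) hbd
      (fun i hi => QuditEntropy.trace_mul_reduced_commutator_eq_zero hρt A _ (hloc.supported i) hi)
      (fun i hi _ => QuditEntropy.norm_trace_mul_reduced_commutator_rpow_le hρt A hα.le
        (hloc.supported i) hi)
    rw [abs_mul, abs_div, abs_inv, abs_of_pos hpos]
    calc _ ≤ |1 - α|⁻¹ * (((QuditEntropy.numStraddling h A : ℝ) * hbar *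
          (2 * α * (d₀ : ℝ) ^ (2 * (k - 1)) * (cfc (fun x : ℝ => x ^ α)
          (QuditEntropy.reduced A
            (QuditEntropy.evolve (QuditEntropy.hamiltonian h) ρ t))).trace.re)) /
          (cfc (fun x : ℝ => x ^ α) (QuditEntropy.reduced A
            (QuditEntropy.evolve (QuditEntropy.hamiltonian h) ρ t))).trace.re) := by
          gcongr
      _ = _ := by field_simp
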